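/- **The cast calculus $\lambda_G$.** Types are $A,B ::= {?} \mid 1 \mid A\times B \mid A+B \mid A\to B$; tag types $G$ are $1,\ {?}\times{?},\ {?}+{?},\ {?}\to{?}$. For $A\neq{?}$ let $\lfloor A\rfloor$ be the tag type with the same outermost constructor as $A$. Terms are $$t,s ::= \mho \mid x \mid \langle B\Leftarrow A\rangle t \mid () \mid (t,s) \mid \mathsf{let}\,(x,y)=t\,\mathsf{in}\,s \mid \mathsf{inj}\,t \mid \mathsf{inj}'\,t \mid \mathsf{case}\,t\,\{\mathsf{inj}\,x.\,s \mid \mathsf{inj}'\,x'.\,s'\} \mid \lambda x{:}A.\,t \mid t\,s,$$ up to renaming of bound variables. Typing $\Gamma\vdash t:A$ is the usual simple typing, with $\Gamma\vdash\mho:A$ for every $A$, and $\Gamma\vdash\langle B\Leftarrow A\rangle t:B$ for all $A,B$ whenever $\Gamma\vdash t:A$. Values are $v ::= \langle {?}\Leftarrow G\rangle v \mid () \mid (v,v') \mid \mathsf{inj}\,v \mid \mathsf{inj}'\,v \mid \lambda x{:}A.\,t$. Evaluation contexts $E$ are those of left-to-right call-by-value: $$E ::= [\cdot] \mid \langle B\Leftarrow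 A\rangle E \mid (E,s) \mid (v,E) \mid \mathsf{let}\,(x,y)=E\,\mathsf{in}\,s \mid \mathsf{inj}\,E \mid \mathsf{inj}'\,E \mid \mathsf{case}\,E\,\{\ldots\} \mid E\,s \mid v\,E.$$ Small-step reduction $\mapsto$ consists of the following rules. First, $E[\mho]\mapsto\mho$ for $E\ne[\cdot]$. Second, $E[r]\mapsto E[r']$ whenever $r\rightsquigarrow r'$ is one of the usual $\beta$-rules for pairs, sums and functions applied to values, or one of * $\langle{?}\Leftarrow{?}\rangle v\rightsquigarrow v$ and $\langle 1\Leftarrow 1\rangle v\rightsquigarrow v$; * $\langle{?}\Leftarrow A\rangle v\rightsquigarrow\langle{?}\Leftarrow\lfloor A\rfloor\rangle\langle\lfloor A\rfloor\Leftarrow A\rangle v$ and $\langle A\Leftarrow{?}\rangle v\rightsquigarrow\langle A\Leftarrow\lfloor A\rfloor\rangle\langle\lfloor A\rfloor\Leftarrow{?}\rangle v$, if $A\ne{?}$ and $\lfloor A\rfloor\neq A$; * $\langle G\Leftarrow{?}\rangle\langle{?}\Leftarrow G\rangle v\rightsquigarrow v$; * $\langle A_2\times B_2\Leftarrow A_1\times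 B_1\rangle(v,v')\rightsquigarrow(\langle A_2\Leftarrow A_1\rangle v,\langle B_2\Leftarrow B_1\rangle v')$; * $\langle A_2+B_2\Leftarrow A_1+B_1\rangle(\mathsf{inj}\,v)\rightsquigarrow\mathsf{inj}\,(\langle A_2\Leftarrow A_1\rangle v)$ and $\langle A_2+B_2\Leftarrow A_1+B_1\rangle(\mathsf{inj}'\,v)\rightsquigarrow\mathsf{inj}'\,(\langle B_2\Leftarrow B_1\rangle v)$; * $\langle A_2\to B_2\Leftarrow A_1\to B_1\rangle v\rightsquigarrow\lambda x{:}A_2.\,\langle B_2\Leftarrow B_1\rangle\bigl(v\,(\langle A_1\Leftarrow A_2\rangle x)\bigr)$. Third, $E[\langle G\Leftarrow{?}\rangle\langle{?}\Leftarrow G'\rangle v]\mapsto\mho$ if $G\ne G'$, and $E[\langle B\Leftarrow A\rangle v]\mapsto\mho$ if $A,B\ne{?}$ and $\lfloor A\rfloor\ne\lfloor B\rfloor$. A term diverges if it has an infinite reduction sequence. **Observational error approximation.** A program context $C$ is a term with one hole in an arbitrary position, whose binders may capture; it is typed $\Gamma'\vdash C[\Gamma\vdash\cdot:A]:B$ when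 $\Gamma'\vdash C[t]:B$ for every $\Gamma\vdash t:A$. For $\Gamma\vdash t,t':A$, write $\Gamma\vDash t\sqsubseteq^{\mathrm{obs}}t':A$ if for all $B$ and all contexts $\cdot\vdash C[\Gamma\vdash\cdot:A]:B$, either $C[t]$ reduces to $\mho$, or both $C[t]$ and $C[t']$ reduce to values, or both diverge. **Dynamism.** Type dynamism $A\sqsubseteq B$ is the least reflexive and transitive relation with $A\sqsubseteq{?}$ for all $A$ for which $\times$, $+$ and $\to$ are monotone in both arguments. Write $\Gamma_1\sqsubseteq\Gamma_2$ if the two environments have the same length and related types at each position. Syntactic term dynamism $\Gamma_1\sqsubseteq\Gamma_2\vdash t_1\sqsubseteq t_2:A_1\sqsubseteq A_2$ is inductively generated by one congruence rule for each term former except $\mho$. The rule for casts is: from $\Gamma_1\sqsubseteq\Gamma_2\vdash t_1\sqsubseteq t_2:A_1\sqsubseteq A_2$ and $B_1\sqsubseteq B_2$ infer $\Gamma_1\sqsubseteq\Gamma_2\vdash\langle B_1\Leftarrow A_1\rangle t_1\sqsubseteq\langle B_2\Leftarrow A_2\rangle t_2:B_1\sqsubseteq B_2$. Variables at the same position of $\Gamma_1\sqsubseteq\Gamma_2$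 are related at their types; $()\sqsubseteq()$ at $1\sqsubseteq 1$; the injection rules also require the types of the other summand to be related; and the remaining rules (pairs, pair matching, case, $\lambda$, application) relate terms whose corresponding immediate subterms are related, at the corresponding types and in environments extended by the types of the bound variables. **Theorem (Graduality).** If $\Gamma_1\sqsubseteq\Gamma_2\vdash t_1\sqsubseteq t_2:A_1\sqsubseteq A_2$, then $t_1$ is observationally less dynamic than $t_2$. That is, $\Gamma_1\sqsubseteq\Gamma_2$, $A_1\sqsubseteq A_2$, $\Gamma_1\vdash t_1:A_1$, $\Gamma_2\vdash t_2:A_2$, and, writing $\Gamma_i=x_{i,1}:A_{i,1},\ldots,x_{i,n}:A_{i,n}$, $$\Gamma_1\vDash\langle A_2\Leftarrow A_1\rangle t_1\ \sqsubseteq^{\mathrm{obs}}\ \mathsf{let}\,x_{2,1}=\langle A_{2,1}\Leftarrow A_{1,1}\rangle x_{1,1}\,\mathsf{in}\,\cdots\,\mathsf{let}\,x_{2,n}=\langle A_{2,n}\Leftarrow A_{1,n}\rangle x_{1,n}\,\mathsf{in}\,t_2\ :A_2,$$ where $\mathsf{let}\,x=t\,\mathsf{in}\,s$ with $x:A$ abbreviates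 $(\lambda x{:}A.\,s)\,t$. -/

import Mathlib

namespace LambdaG

/-! ## Syntax of the cast calculus (de Bruijn representation, index 0 is the innermost binder) -/

/-- Types: the dynamic type, unit, products, sums and functions. -/
inductive Ty : Type
  | dyn : Ty
  | unit : Ty
  | prod : Ty → Ty → Ty
  | sum : Ty → Ty → Ty
  | arr : Ty → Ty → Ty
  deriving DecidableEq

/-- The tag types `1`, `? × ?`, `? + ?`, `? → ?`. -/
inductive IsTag : Ty → Prop
  | unit : IsTag Ty.unit
  | prod : IsTag (Ty.prod Ty.dyn Ty.dyn)
  | sum : IsTag (Ty.sum Ty.dyn Ty.dyn)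
  | arr : IsTag (Ty.arr Ty.dyn Ty.dyn)

/-- The tag type underlying a non-dynamic type. The value at `dyn` is a dummy: every use below is
guarded by the hypothesis that the argument is not `dyn`. -/
def Ty.floor : Ty → Ty
  | .dyn => .dyn
  | .unit => .unit
  | .prod _ _ => .prod .dyn .dyn
  | .sum _ _ => .sum .dyn .dyn
  | .arr _ _ => .arr .dyn .dyn

/-- Terms. `cast A B t` is the cast of `t` from `A` to `B`; `err` is the dynamic type error.
`letPair t s` is `let (x, y) = t in s`: in `s`, `y` has index 0 and `x` has index 1.
`case t s s'` binds one variable in each of `s` and `s'`; `lam A t` binds one variable in `t`. -/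
inductive Tm : Type
  | err : Tm
  | var : ℕ → Tm
  | cast : Ty → Ty → Tm → Tm
  | unit : Tm
  | pair : Tm → Tm → Tm
  | letPair : Tm → Tm → Tm
  | inl : Tm → Tm
  | inr : Tm → Tm
  | case : Tm → Tm → Tm → Tm
  | lam : Ty → Tm → Tm
  | app : Tm → Tm → Tm

/-- Values. -/
inductive Value : Tm → Prop
  | tag {G : Ty} {v : Tm} : IsTag G → Value v → Value (.cast G .dyn v)
  | unit : Value .unit
  | pair {v v' : Tm} : Value v → Value v' → Value (.pair v v')
  | inl {v : Tm} : Value v → Value (.inl v)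
  | inr {v : Tm} : Value v → Value (.inr v)
  | lam {A : Ty} {t : Tm} : Value (.lam A t)

/-- Environments, with the innermost variable at the head: the list `[Aₙ, …, A₁]` represents
`x₁ : A₁, …, xₙ : Aₙ`. -/
abbrev Env : Type := List Ty

/-! ## Typing -/

/-- The typing judgement `Γ ⊢ t : A`. -/
inductive HasType : Env → Tm → Ty → Prop
  | err {Γ : Env} {A : Ty} : HasType Γ .err A
  | var {Γ : Env} {i : ℕ} {A : Ty} : Γ[i]? = some A → HasType Γ (.var i) A
  | cast {Γ : Env} {t : Tm} {A B : Ty} : HasType Γ t A → HasType Γ (.cast A B t) B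
  | unit {Γ : Env} : HasType Γ .unit .unit
  | pair {Γ : Env} {t t' : Tm} {A A' : Ty} :
      HasType Γ t A → HasType Γ t' A' → HasType Γ (.pair t t') (.prod A A')
  | letPair {Γ : Env} {t s : Tm} {A A' B : Ty} :
      HasType Γ t (.prod A A') → HasType (A' :: A :: Γ) s B → HasType Γ (.letPair t s) B
  | inl {Γ : Env} {t : Tm} {A A' : Ty} : HasType Γ t A → HasType Γ (.inl t) (.sum A A')
  | inr {Γ : Env} {t : Tm} {A A' : Ty} : HasType Γ t A' → HasType Γ (.inr t) (.sum A A')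
  | case {Γ : Env} {t s s' : Tm} {A A' B : Ty} :
      HasType Γ t (.sum A A') → HasType (A :: Γ) s B → HasType (A' :: Γ) s' B →
      HasType Γ (.case t s s') B
  | lam {Γ : Env} {t : Tm} {A B : Ty} : HasType (A :: Γ) t B → HasType Γ (.lam A t) (.arr A B)
  | app {Γ : Env} {t s : Tm} {A B : Ty} :
      HasType Γ t (.arr A B) → HasType Γ s A → HasType Γ (.app t s) B

/-! ## Renaming and capture-avoiding substitution -/

/-- Lift a renaming under one binder. -/
def liftRen (ξ : ℕ → ℕ) : ℕ → ℕ
  | 0 => 0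
  | i + 1 => ξ i + 1

/-- Apply a renaming to the free variables of a term. -/
def Tm.rename : (ℕ → ℕ) → Tm → Tm
  | _, .err => .err
  | ξ, .var i => .var (ξ i)
  | ξ, .cast A B t => .cast A B (t.rename ξ)
  | _, .unit => .unit
  | ξ, .pair t s => .pair (t.rename ξ) (s.rename ξ)
  | ξ, .letPair t s => .letPair (t.rename ξ) (s.rename (liftRen (liftRen ξ)))
  | ξ, .inl t => .inl (t.rename ξ)
  | ξ, .inr t => .inr (t.rename ξ)
  | ξ, .case t s s' => .case (t.rename ξ) (s.rename (liftRen ξ)) (s'.rename (liftRen ξ))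
  | ξ, .lam A t => .lam A (t.rename (liftRen ξ))
  | ξ, .app t s => .app (t.rename ξ) (s.rename ξ)

/-- Lift a substitution under one binder. -/
def liftSub (σ : ℕ → Tm) : ℕ → Tm
  | 0 => .var 0
  | i + 1 => (σ i).rename Nat.succ

/-- Simultaneous capture-avoiding substitution. -/
def Tm.subst : (ℕ → Tm) → Tm → Tm
  | _, .err => .err
  | σ, .var i => σ i
  | σ, .cast A B t => .cast A B (t.subst σ)
  | _, .unit => .unit
  | σ, .pair t s => .pair (t.subst σ) (s.subst σ)
  | σ, .letPair t s => .letPair (t.subst σ) (s.subst (liftSub (liftSub σ)))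
  | σ, .inl t => .inl (t.subst σ)
  | σ, .inr t => .inr (t.subst σ)
  | σ, .case t s s' => .case (t.subst σ) (s.subst (liftSub σ)) (s'.subst (liftSub σ))
  | σ, .lam A t => .lam A (t.subst (liftSub σ))
  | σ, .app t s => .app (t.subst σ) (s.subst σ)

/-- Extend a substitution by a term for the variable 0. -/
def consSub (v : Tm) (σ : ℕ → Tm) : ℕ → Tm
  | 0 => v
  | i + 1 => σ i

/-- `t[v/x]`, where `x` is the variable 0. -/
def Tm.inst (t v : Tm) : Tm := t.subst (consSub v .var)

/-- `t[v/x, v'/y]`, where `y` is the variable 0 and `x` the variable 1. -/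
def Tm.inst₂ (t v v' : Tm) : Tm := t.subst (consSub v' (consSub v .var))

/-! ## Contexts -/

/-- Program contexts: terms with exactly one hole, at an arbitrary position. -/
inductive Ctx : Type
  | hole : Ctx
  | cast : Ty → Ty → Ctx → Ctx
  | pairL : Ctx → Tm → Ctx
  | pairR : Tm → Ctx → Ctx
  | letPairL : Ctx → Tm → Ctx
  | letPairR : Tm → Ctx → Ctx
  | inl : Ctx → Ctx
  | inr : Ctx → Ctx
  | case₀ : Ctx → Tm → Tm → Ctx
  | case₁ : Tm → Ctx → Tm → Ctx
  | case₂ : Tm → Tm → Ctx → Ctx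
  | lam : Ty → Ctx → Ctx
  | appL : Ctx → Tm → Ctx
  | appR : Tm → Ctx → Ctx

/-- `C[t]`: replace the hole by `t`. The binders of `C` around the hole capture variables of `t`. -/
def Ctx.plug : Ctx → Tm → Tm
  | .hole, t => t
  | .cast A B C, t => .cast A B (C.plug t)
  | .pairL C s, t => .pair (C.plug t) s
  | .pairR s C, t => .pair s (C.plug t)
  | .letPairL C s, t => .letPair (C.plug t) s
  | .letPairR s C, t => .letPair s (C.plug t)
  | .inl C, t => .inl (C.plug t)
  | .inr C, t => .inr (C.plug t)
  | .case₀ C s s', t => .case (C.plug t) s s'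
  | .case₁ r C s', t => .case r (C.plug t) s'
  | .case₂ r s C, t => .case r s (C.plug t)
  | .lam A C, t => .lam A (C.plug t)
  | .appL C s, t => .app (C.plug t) s
  | .appR s C, t => .app s (C.plug t)

/-- The context typing `Γ' ⊢ C[Γ ⊢ · : A] : B`: plugging in any term `Γ ⊢ t : A` gives a term
`Γ' ⊢ C[t] : B`. -/
def Ctx.Typed (C : Ctx) (Γ : Env) (A : Ty) (Γ' : Env) (B : Ty) : Prop :=
  ∀ t : Tm, HasType Γ t A → HasType Γ' (C.plug t) B

/-- The contexts that are evaluation contexts (left-to-right, call by value). -/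
inductive IsEval : Ctx → Prop
  | hole : IsEval .hole
  | cast {A B : Ty} {E : Ctx} : IsEval E → IsEval (.cast A B E)
  | pairL {E : Ctx} {s : Tm} : IsEval E → IsEval (.pairL E s)
  | pairR {v : Tm} {E : Ctx} : Value v → IsEval E → IsEval (.pairR v E)
  | letPair {E : Ctx} {s : Tm} : IsEval E → IsEval (.letPairL E s)
  | inl {E : Ctx} : IsEval E → IsEval (.inl E)
  | inr {E : Ctx} : IsEval E → IsEval (.inr E)
  | case {E : Ctx} {s s' : Tm} : IsEval E → IsEval (.case₀ E s s')
  | appL {E : Ctx} {s : Tm} : IsEval E → IsEval (.appL E s)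
  | appR {v : Tm} {E : Ctx} : Value v → IsEval E → IsEval (.appR v E)

/-! ## Operational semantics -/

/-- Reductions that take place inside an evaluation context. -/
inductive Red : Tm → Tm → Prop
  | caseInl {v t t' : Tm} : Value v → Red (.case (.inl v) t t') (t.inst v)
  | caseInr {v t t' : Tm} : Value v → Red (.case (.inr v) t t') (t'.inst v)
  | letPair {v v' t : Tm} : Value v → Value v' → Red (.letPair (.pair v v') t) (t.inst₂ v v')
  | beta {A : Ty} {t v : Tm} : Value v → Red (.app (.lam A t) v) (t.inst v)
  | dynDyn {v : Tm} : Value v → Red (.cast .dyn .dyn v) v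
  | unitUnit {v : Tm} : Value v → Red (.cast .unit .unit v) v
  | tagUp {A : Ty} {v : Tm} : Value v → A ≠ .dyn → A.floor ≠ A →
      Red (.cast A .dyn v) (.cast A.floor .dyn (.cast A A.floor v))
  | tagDn {A : Ty} {v : Tm} : Value v → A ≠ .dyn → A.floor ≠ A →
      Red (.cast .dyn A v) (.cast A.floor A (.cast .dyn A.floor v))
  | tagMatch {G : Ty} {v : Tm} : Value v → IsTag G →
      Red (.cast .dyn G (.cast G .dyn v)) v
  | castPair {A₁ B₁ A₂ B₂ : Ty} {v v' : Tm} : Value v → Value v' →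
      Red (.cast (.prod A₁ B₁) (.prod A₂ B₂) (.pair v v'))
        (.pair (.cast A₁ A₂ v) (.cast B₁ B₂ v'))
  | castInl {A₁ B₁ A₂ B₂ : Ty} {v : Tm} : Value v →
      Red (.cast (.sum A₁ B₁) (.sum A₂ B₂) (.inl v)) (.inl (.cast A₁ A₂ v))
  | castInr {A₁ B₁ A₂ B₂ : Ty} {v : Tm} : Value v →
      Red (.cast (.sum A₁ B₁) (.sum A₂ B₂) (.inr v)) (.inr (.cast B₁ B₂ v))
  | castFun {A₁ B₁ A₂ B₂ : Ty} {v : Tm} : Value v →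
      Red (.cast (.arr A₁ B₁) (.arr A₂ B₂) v)
        (.lam A₂ (.cast B₁ B₂ (.app (v.rename Nat.succ) (.cast A₂ A₁ (.var 0)))))

/-- Failing casts: they abort the whole program. -/
inductive Fails : Tm → Prop
  | tagMismatch {G G' : Ty} {v : Tm} : Value v → IsTag G → IsTag G' → G ≠ G' →
      Fails (.cast .dyn G (.cast G' .dyn v))
  | tagMismatch' {A B : Ty} {v : Tm} : Value v → A ≠ .dyn → B ≠ .dyn → A.floor ≠ B.floor →
      Fails (.cast A B v)

/-- Small-step semantics. An error propagates out of every nonempty evaluation context, so that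
`err` itself is irreducible. -/
inductive Step : Tm → Tm → Prop
  | red {E : Ctx} {t t' : Tm} : IsEval E → Red t t' → Step (E.plug t) (E.plug t')
  | err {E : Ctx} : IsEval E → E ≠ .hole → Step (E.plug .err) .err
  | fail {E : Ctx} {t : Tm} : IsEval E → Fails t → Step (E.plug t) .err

/-- `t` reduces to a value. -/
def ReducesToValue (t : Tm) : Prop := ∃ v, Value v ∧ Relation.ReflTransGen Step t v

/-- `t` reduces to the dynamic type error. -/
def ReducesToErr (t : Tm) : Prop := Relation.ReflTransGen Step t .err

/-- `t` diverges: it starts an infinite reduction sequence. -/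
def Diverges (t : Tm) : Prop := ∃ f : ℕ → Tm, f 0 = t ∧ ∀ n, Step (f n) (f (n + 1))

/-! ## Observational error approximation -/

/-- `Γ ⊨ t ⊑ᵒᵇˢ t' : A` for well-typed terms `Γ ⊢ t, t' : A`. -/
structure ObsApprox (Γ : Env) (t t' : Tm) (A : Ty) : Prop where
  left_typed : HasType Γ t A
  right_typed : HasType Γ t' A
  approx : ∀ (C : Ctx) (B : Ty), C.Typed Γ A [] B →
    ReducesToErr (C.plug t) ∨
    (ReducesToValue (C.plug t) ∧ ReducesToValue (C.plug t')) ∨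
    (Diverges (C.plug t) ∧ Diverges (C.plug t'))

/-! ## Type dynamism and syntactic term dynamism -/

/-- Type dynamism `A ⊑ B`. -/
inductive TyDyn : Ty → Ty → Prop
  | refl {A : Ty} : TyDyn A A
  | trans {A₁ A₂ A₃ : Ty} : TyDyn A₁ A₂ → TyDyn A₂ A₃ → TyDyn A₁ A₃
  | top {A : Ty} : TyDyn A .dyn
  | sum {A₁ A₂ B₁ B₂ : Ty} : TyDyn A₁ A₂ → TyDyn B₁ B₂ → TyDyn (.sum A₁ B₁) (.sum A₂ B₂)
  | prod {A₁ A₂ B₁ B₂ : Ty} : TyDyn A₁ A₂ → TyDyn B₁ B₂ → TyDyn (.prod A₁ B₁) (.prod A₂ B₂)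
  | arr {A₁ A₂ B₁ B₂ : Ty} : TyDyn A₁ A₂ → TyDyn B₁ B₂ → TyDyn (.arr A₁ B₁) (.arr A₂ B₂)

/-- Environment dynamism `Γ₁ ⊑ Γ₂`: same length and pointwise type dynamism. -/
abbrev EnvDyn : Env → Env → Prop := List.Forall₂ TyDyn

/-- Syntactic term dynamism `Γ₁ ⊑ Γ₂ ⊢ t₁ ⊑ t₂ : A₁ ⊑ A₂`. -/
inductive TmDyn : Env → Env → Tm → Tm → Ty → Ty → Prop
  | cast {Γ₁ Γ₂ : Env} {t₁ t₂ : Tm} {A₁ A₂ B₁ B₂ : Ty} :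
      TmDyn Γ₁ Γ₂ t₁ t₂ A₁ A₂ → TyDyn B₁ B₂ →
      TmDyn Γ₁ Γ₂ (.cast A₁ B₁ t₁) (.cast A₂ B₂ t₂) B₁ B₂
  | var {Γ₁ Γ₂ : Env} {i : ℕ} {A₁ A₂ : Ty} :
      EnvDyn Γ₁ Γ₂ → Γ₁[i]? = some A₁ → Γ₂[i]? = some A₂ →
      TmDyn Γ₁ Γ₂ (.var i) (.var i) A₁ A₂
  | unit {Γ₁ Γ₂ : Env} : EnvDyn Γ₁ Γ₂ → TmDyn Γ₁ Γ₂ .unit .unit .unit .unit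
  | pair {Γ₁ Γ₂ : Env} {t₁ t₂ t₁' t₂' : Tm} {A₁ A₂ A₁' A₂' : Ty} :
      TmDyn Γ₁ Γ₂ t₁ t₂ A₁ A₂ → TmDyn Γ₁ Γ₂ t₁' t₂' A₁' A₂' →
      TmDyn Γ₁ Γ₂ (.pair t₁ t₁') (.pair t₂ t₂') (.prod A₁ A₁') (.prod A₂ A₂')
  | letPair {Γ₁ Γ₂ : Env} {t₁ t₂ t₁' t₂' : Tm} {A₁ A₂ A₁' A₂' B₁ B₂ : Ty} :
      TmDyn Γ₁ Γ₂ t₁ t₂ (.prod A₁ A₁') (.prod A₂ A₂') →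
      TmDyn (A₁' :: A₁ :: Γ₁) (A₂' :: A₂ :: Γ₂) t₁' t₂' B₁ B₂ →
      TmDyn Γ₁ Γ₂ (.letPair t₁ t₁') (.letPair t₂ t₂') B₁ B₂
  | inl {Γ₁ Γ₂ : Env} {t₁ t₂ : Tm} {A₁ A₂ A₁' A₂' : Ty} :
      TmDyn Γ₁ Γ₂ t₁ t₂ A₁ A₂ → TyDyn A₁' A₂' →
      TmDyn Γ₁ Γ₂ (.inl t₁) (.inl t₂) (.sum A₁ A₁') (.sum A₂ A₂')
  | inr {Γ₁ Γ₂ : Env} {t₁ t₂ : Tm} {A₁ A₂ A₁' A₂' : Ty} :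
      TmDyn Γ₁ Γ₂ t₁ t₂ A₁' A₂' → TyDyn A₁ A₂ →
      TmDyn Γ₁ Γ₂ (.inr t₁) (.inr t₂) (.sum A₁ A₁') (.sum A₂ A₂')
  | case {Γ₁ Γ₂ : Env} {t₁ t₂ s₁ s₂ s₁' s₂' : Tm} {A₁ A₂ A₁' A₂' B₁ B₂ : Ty} :
      TmDyn Γ₁ Γ₂ t₁ t₂ (.sum A₁ A₁') (.sum A₂ A₂') →
      TmDyn (A₁ :: Γ₁) (A₂ :: Γ₂) s₁ s₂ B₁ B₂ →
      TmDyn (A₁' :: Γ₁) (A₂' :: Γ₂) s₁' s₂' B₁ B₂ →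
      TmDyn Γ₁ Γ₂ (.case t₁ s₁ s₁') (.case t₂ s₂ s₂') B₁ B₂
  | lam {Γ₁ Γ₂ : Env} {t₁ t₂ : Tm} {A₁ A₂ B₁ B₂ : Ty} :
      TmDyn (A₁ :: Γ₁) (A₂ :: Γ₂) t₁ t₂ B₁ B₂ →
      TmDyn Γ₁ Γ₂ (.lam A₁ t₁) (.lam A₂ t₂) (.arr A₁ B₁) (.arr A₂ B₂)
  | app {Γ₁ Γ₂ : Env} {t₁ t₂ s₁ s₂ : Tm} {A₁ A₂ B₁ B₂ : Ty} :
      TmDyn Γ₁ Γ₂ t₁ t₂ (.arr A₁ B₁) (.arr A₂ B₂) → TmDyn Γ₁ Γ₂ s₁ s₂ A₁ A₂ →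
      TmDyn Γ₁ Γ₂ (.app t₁ s₁) (.app t₂ s₂) B₁ B₂

/-! ## Observational term dynamism -/

/-- `let x : A = t in s`, the usual abbreviation for `(λ x : A. s) t`. -/
def Tm.letIn (A : Ty) (t s : Tm) : Tm := .app (.lam A s) t

/-- Auxiliary function for `envLet`: wraps the bindings from the innermost to the outermost. -/
def envLetAux (k : ℕ) : Env → Env → Tm → Tm
  | A₁ :: Γ₁, A₂ :: Γ₂, t => envLetAux k Γ₁ Γ₂ (.letIn A₂ (.cast A₁ A₂ (.var k)) t)
  | _, _, t => t

/-- For `Γ₁ = x₁₁ : A₁₁, …, x₁ₙ : A₁ₙ` and `Γ₂ = x₂₁ : A₂₁, …, x₂ₙ : A₂ₙ`, the term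
`let x₂₁ = ⟨A₂₁ ⇐ A₁₁⟩ x₁₁ in … let x₂ₙ = ⟨A₂ₙ ⇐ A₁ₙ⟩ x₁ₙ in t`
in the environment `Γ₁`, where `t` is a term in the environment `Γ₂`. In the `i`-th binding,
`x₁ᵢ` lies below `x₁,ᵢ₊₁, …, x₁ₙ, x₂₁, …, x₂,ᵢ₋₁`, so that its index is `n - 1` for every `i`;
the indices of the variables of `t` do not change. -/
def envLet (Γ₁ Γ₂ : Env) (t : Tm) : Tm := envLetAux (Γ₁.length - 1) Γ₁ Γ₂ t

/-- `Γ₁ ⊢ t₁ : B₁` is observationally less dynamic than `Γ₂ ⊢ t₂ : B₂`: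
`Γ₁ ⊑ Γ₂ ⊨ t₁ ⊑ᵒᵇˢ t₂ : B₁ ⊑ B₂`. -/
structure ObsTmDyn (Γ₁ Γ₂ : Env) (t₁ t₂ : Tm) (B₁ B₂ : Ty) : Prop where
  env_dyn : EnvDyn Γ₁ Γ₂
  ty_dyn : TyDyn B₁ B₂
  left_typed : HasType Γ₁ t₁ B₁
  right_typed : HasType Γ₂ t₂ B₂
  approx : ObsApprox Γ₁ (.cast B₁ B₂ t₁) (envLet Γ₁ Γ₂ t₂) B₂

end LambdaG

namespace LambdaG

/-! ## Substitution -/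

/-! The proof is a step-indexed logical relation between terms of possibly different types. Related
values have the same structure, except that the right one may carry extra tags. Untagging replaces
`?` by a larger type, so recursion on types is unavailable: `ValueRelOver` is inductive on the
values, and only function bodies consume an index. Terms are related when termination within the
index on one chosen side forces either failure on the left or evaluation of both to related values
(`TermRel`). Counting on the left transfers termination from left to right, and counting on the
right transfers it back up to errors; in `Sem.adequate` only joint divergence is left over.
Termination means reaching any irreducible term, so the relation itself rules out stuck terms, and
neither progress nor preservation is needed.

The heart is `castRel`: for `A₁ ⊑ A₂` and `B₁ ⊑ B₂`, the casts `A₁` to `B₁` and `A₂` to `B₂`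
preserve the relation. The more precise cast checks more, so it alone may fail on its own. Casting
related values never diverges, so no index is spent and the induction is on the height of types,
where `?` has height zero.

Given `castRel`, congruence yields `TmDyn.sem`, and reflexivity (`HasType.sem`) yields closure under
program contexts (`Sem.plug`). The casts in the conclusion are squares with an identity on one side,
so `Sem.envLet` passes to a single environment and type without any transitivity of the logical
relation. -/

theorem liftRen_comp (ξ ζ : ℕ → ℕ) :
    (fun i => liftRen ζ (liftRen ξ i)) = liftRen (fun i => ζ (ξ i)) := by
  funext i; cases i <;> rfl

theorem Tm.rename_rename (t : Tm) (ξ ζ : ℕ → ℕ) :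
    (t.rename ξ).rename ζ = t.rename (fun i => ζ (ξ i)) := by
  induction t generalizing ξ ζ <;> simp_all [Tm.rename, liftRen_comp]

theorem liftSub_liftRen (ξ : ℕ → ℕ) (σ : ℕ → Tm) :
    (fun i => liftSub σ (liftRen ξ i)) = liftSub (fun i => σ (ξ i)) := by
  funext i; cases i <;> rfl

theorem Tm.rename_subst (t : Tm) (ξ : ℕ → ℕ) (σ : ℕ → Tm) :
    (t.rename ξ).subst σ = t.subst (fun i => σ (ξ i)) := by
  induction t generalizing ξ σ <;> simp_all [Tm.rename, Tm.subst, liftSub_liftRen]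

theorem liftSub_rename (σ : ℕ → Tm) (ξ : ℕ → ℕ) :
    (fun i => (liftSub σ i).rename (liftRen ξ)) = liftSub (fun i => (σ i).rename ξ) := by
  funext i; cases i <;> simp [liftSub, Tm.rename, liftRen, Tm.rename_rename]

theorem Tm.subst_rename (t : Tm) (σ : ℕ → Tm) (ξ : ℕ → ℕ) :
    (t.subst σ).rename ξ = t.subst (fun i => (σ i).rename ξ) := by
  induction t generalizing ξ σ <;> simp_all [Tm.rename, Tm.subst, liftSub_rename]

theorem liftSub_subst (σ τ : ℕ → Tm) :
    (fun i => (liftSub σ i).subst (liftSub τ)) = liftSub (fun i => (σ i).subst τ) := by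
  funext i
  cases i <;> simp [liftSub, Tm.subst, Tm.rename_subst, Tm.subst_rename]

theorem Tm.subst_subst (t : Tm) (σ τ : ℕ → Tm) :
    (t.subst σ).subst τ = t.subst (fun i => (σ i).subst τ) := by
  induction t generalizing σ τ <;> simp_all [Tm.subst, liftSub_subst]

theorem liftSub_var : liftSub Tm.var = Tm.var := by
  funext i; cases i <;> rfl

theorem Tm.subst_var (t : Tm) : t.subst .var = t := by
  induction t <;> simp_all [Tm.subst, liftSub_var]

theorem Tm.rename_succ_inst (t v : Tm) : (t.rename Nat.succ).inst v = t := by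
  simp [Tm.inst, Tm.rename_subst, consSub, Tm.subst_var]

theorem Tm.subst_liftSub_inst (t v : Tm) (σ : ℕ → Tm) :
    (t.subst (liftSub σ)).inst v = t.subst (consSub v σ) := by
  rw [Tm.inst, Tm.subst_subst]
  congr 1; funext i
  cases i with
  | zero => rfl
  | succ i => exact Tm.rename_succ_inst _ _

theorem Tm.subst_liftSub_inst₂ (t v v' : Tm) (σ : ℕ → Tm) :
    (t.subst (liftSub (liftSub σ))).inst₂ v v' = t.subst (consSub v' (consSub v σ)) := by
  rw [Tm.inst₂, Tm.subst_subst]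
  congr 1; funext i
  match i with
  | 0 => rfl
  | 1 => rfl
  | i + 2 => simp [liftSub, Tm.rename_subst, consSub, Tm.subst_var]

/-! ## Evaluation contexts and determinism -/

/-- Composition of contexts. -/
def Ctx.comp : Ctx → Ctx → Ctx
  | .hole, D => D
  | .cast A B C, D => .cast A B (C.comp D)
  | .pairL C s, D => .pairL (C.comp D) s
  | .pairR s C, D => .pairR s (C.comp D)
  | .letPairL C s, D => .letPairL (C.comp D) s
  | .letPairR s C, D => .letPairR s (C.comp D)
  | .inl C, D => .inl (C.comp D)
  | .inr C, D => .inr (C.comp D)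
  | .case₀ C s s', D => .case₀ (C.comp D) s s'
  | .case₁ r C s', D => .case₁ r (C.comp D) s'
  | .case₂ r s C, D => .case₂ r s (C.comp D)
  | .lam A C, D => .lam A (C.comp D)
  | .appL C s, D => .appL (C.comp D) s
  | .appR s C, D => .appR s (C.comp D)

theorem Ctx.plug_comp (C D : Ctx) (t : Tm) : (C.comp D).plug t = C.plug (D.plug t) := by
  induction C <;> simp_all [Ctx.comp, Ctx.plug]

theorem IsEval.comp {C D : Ctx} (hC : IsEval C) (hD : IsEval D) : IsEval (C.comp D) := by
  induction hC <;> simp only [Ctx.comp] <;> first | assumption | (constructor <;> assumption)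

theorem Ctx.comp_ne_hole {C D : Ctx} (hD : D ≠ .hole) : C.comp D ≠ .hole := by
  cases C <;> simp [Ctx.comp, hD]

/-- Terms at which evaluation takes place. -/
def Redex (r : Tm) : Prop := (∃ t, Red r t) ∨ Fails r ∨ r = .err

theorem Redex.value_of_cast {A B : Ty} {t : Tm} (h : Redex (.cast A B t)) : Value t := by
  rcases h with ⟨_, h⟩ | h | h
  · cases h <;> first | assumption | (constructor <;> assumption)
  · cases h <;> first | assumption | (constructor <;> assumption)
  · cases h

theorem Redex.value_of_case {t s s' : Tm} (h : Redex (.case t s s')) : Value t := by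
  rcases h with ⟨_, h⟩ | h | h
  · cases h <;> (constructor; assumption)
  · cases h
  · cases h

theorem Redex.value_of_letPair {t s : Tm} (h : Redex (.letPair t s)) : Value t := by
  rcases h with ⟨_, h⟩ | h | h
  · cases h; constructor <;> assumption
  · cases h
  · cases h

theorem Redex.value_of_app {t s : Tm} (h : Redex (.app t s)) : Value t ∧ Value s := by
  rcases h with ⟨_, h⟩ | h | h
  · cases h; exact ⟨.lam, by assumption⟩
  · cases h
  · cases h

theorem not_redex_pair {t s : Tm} : ¬ Redex (.pair t s) := by
  rintro (⟨_, h⟩ | h | h) <;> cases h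

theorem not_redex_inl {t : Tm} : ¬ Redex (.inl t) := by
  rintro (⟨_, h⟩ | h | h) <;> cases h

theorem not_redex_inr {t : Tm} : ¬ Redex (.inr t) := by
  rintro (⟨_, h⟩ | h | h) <;> cases h

theorem IsTag.ne_dyn {G : Ty} (h : IsTag G) : G ≠ .dyn := by cases h <;> simp

theorem IsTag.floor_eq {G : Ty} (h : IsTag G) : G.floor = G := by cases h <;> rfl

theorem isTag_floor {A : Ty} (h : A ≠ .dyn) : IsTag A.floor := by
  cases A <;> first | exact absurd rfl h | constructor

/-- The delicate values are the tagged ones. A cast from a tag type to `?` escapes every rule: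
`tagUp` demands a type different from its floor, and the other cast rules need source `?` or a
target other than `?`. -/
theorem Value.not_redex {v : Tm} (h : Value v) : ¬ Redex v := by
  intro hr
  cases h with
  | tag hG hv =>
    rcases hr with ⟨_, h⟩ | h | h
    · cases h with
      | dynDyn => exact hG.ne_dyn rfl
      | tagUp _ _ h => exact h hG.floor_eq
      | tagDn _ h _ => exact h rfl
      | tagMatch _ h => exact h.ne_dyn rfl
    · cases h with
      | tagMismatch _ h => exact h.ne_dyn rfl
      | tagMismatch' _ _ h => exact h rfl
    · cases h
  | unit => rcases hr with ⟨_, h⟩ | h | h <;> cases h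
  | pair => exact not_redex_pair hr
  | inl => exact not_redex_inl hr
  | inr => exact not_redex_inr hr
  | lam => rcases hr with ⟨_, h⟩ | h | h <;> cases h

theorem IsEval.value_of_plug {E : Ctx} (hE : IsEval E) {t : Tm} (h : Value (E.plug t)) :
    Value t := by
  induction hE with
  | hole => exact h
  | letPair | case | appL | appR => cases h
  | cast _ ih | pairL _ ih | pairR _ _ ih | inl _ ih | inr _ ih =>
    cases h; apply ih; assumption

theorem IsEval.plug_not_value {E : Ctx} (hE : IsEval E) {r : Tm} (hr : Redex r) :
    ¬ Value (E.plug r) := fun h => (hE.value_of_plug h).not_redex hr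

/-- A redex has values in its evaluation positions, and a value has no redex in such a position. -/
theorem IsEval.eq_hole_of_redex {E : Ctx} (hE : IsEval E) {r : Tm} (hr : Redex r)
    (h : Redex (E.plug r)) : E = .hole := by
  cases hE with
  | hole => rfl
  | cast hE => exact absurd h.value_of_cast (hE.plug_not_value hr)
  | pairL => exact absurd h not_redex_pair
  | pairR => exact absurd h not_redex_pair
  | letPair hE => exact absurd h.value_of_letPair (hE.plug_not_value hr)
  | inl => exact absurd h not_redex_inl
  | inr => exact absurd h not_redex_inr
  | case hE => exact absurd h.value_of_case (hE.plug_not_value hr)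
  | appL hE => exact absurd h.value_of_app.1 (hE.plug_not_value hr)
  | appR _ hE => exact absurd h.value_of_app.2 (hE.plug_not_value hr)

/-- Two decompositions could part only where one context stops, which `IsEval.eq_hole_of_redex`
excludes, or where one enters the left component and the other the right, which would require the
left component to be a value. -/
theorem unique_decomposition {E E' : Ctx} (hE : IsEval E) (hE' : IsEval E') {r r' : Tm}
    (hr : Redex r) (hr' : Redex r') (h : E.plug r = E'.plug r') : E = E' ∧ r = r' := by
  induction hE generalizing E' with
  | hole =>
    have := hE'.eq_hole_of_redex hr' (h ▸ hr)
    subst this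
    exact ⟨rfl, h⟩
  | @cast A B E hE ih =>
    cases hE' with
    | hole =>
      exact absurd (IsEval.eq_hole_of_redex (E := .cast A B E) (.cast hE) hr (h ▸ hr')) (by simp)
    | cast hE' =>
      simp only [Ctx.plug, Tm.cast.injEq] at h
      obtain ⟨rfl, rfl, h⟩ := h
      obtain ⟨rfl, rfl⟩ := ih hE' h
      exact ⟨rfl, rfl⟩
    | _ => simp [Ctx.plug] at h
  | @pairL E s hE ih =>
    cases hE' with
    | hole =>
      exact absurd (IsEval.eq_hole_of_redex (E := .pairL E s) (.pairL hE) hr (h ▸ hr')) (by simp)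
    | pairL hE' =>
      simp only [Ctx.plug, Tm.pair.injEq] at h
      obtain ⟨h, rfl⟩ := h
      obtain ⟨rfl, rfl⟩ := ih hE' h
      exact ⟨rfl, rfl⟩
    | pairR hv =>
      simp only [Ctx.plug, Tm.pair.injEq] at h
      exact absurd (h.1 ▸ hv) (hE.plug_not_value hr)
    | _ => simp [Ctx.plug] at h
  | @pairR v E hv hE ih =>
    cases hE' with
    | hole =>
      exact absurd (IsEval.eq_hole_of_redex (E := .pairR v E) (.pairR hv hE) hr (h ▸ hr')) (by simp)
    | pairR _ hE' =>
      simp only [Ctx.plug, Tm.pair.injEq] at h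
      obtain ⟨rfl, h⟩ := h
      obtain ⟨rfl, rfl⟩ := ih hE' h
      exact ⟨rfl, rfl⟩
    | pairL hE' =>
      simp only [Ctx.plug, Tm.pair.injEq] at h
      exact absurd (h.1 ▸ hv) (hE'.plug_not_value hr')
    | _ => simp [Ctx.plug] at h
  | @letPair E s hE ih =>
    cases hE' with
    | hole =>
      exact absurd (IsEval.eq_hole_of_redex (E := .letPairL E s) (.letPair hE) hr (h ▸ hr'))
        (by simp)
    | letPair hE' =>
      simp only [Ctx.plug, Tm.letPair.injEq] at h
      obtain ⟨h, rfl⟩ := h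
      obtain ⟨rfl, rfl⟩ := ih hE' h
      exact ⟨rfl, rfl⟩
    | _ => simp [Ctx.plug] at h
  | @inl E hE ih =>
    cases hE' with
    | hole =>
      exact absurd (IsEval.eq_hole_of_redex (E := .inl E) (.inl hE) hr (h ▸ hr')) (by simp)
    | inl hE' =>
      simp only [Ctx.plug, Tm.inl.injEq] at h
      obtain ⟨rfl, rfl⟩ := ih hE' h
      exact ⟨rfl, rfl⟩
    | _ => simp [Ctx.plug] at h
  | @inr E hE ih =>
    cases hE' with
    | hole =>
      exact absurd (IsEval.eq_hole_of_redex (E := .inr E) (.inr hE) hr (h ▸ hr')) (by simp)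
    | inr hE' =>
      simp only [Ctx.plug, Tm.inr.injEq] at h
      obtain ⟨rfl, rfl⟩ := ih hE' h
      exact ⟨rfl, rfl⟩
    | _ => simp [Ctx.plug] at h
  | @case E s s' hE ih =>
    cases hE' with
    | hole =>
      exact absurd (IsEval.eq_hole_of_redex (E := .case₀ E s s') (.case hE) hr (h ▸ hr')) (by simp)
    | case hE' =>
      simp only [Ctx.plug, Tm.case.injEq] at h
      obtain ⟨h, rfl, rfl⟩ := h
      obtain ⟨rfl, rfl⟩ := ih hE' h
      exact ⟨rfl, rfl⟩
    | _ => simp [Ctx.plug] at h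
  | @appL E s hE ih =>
    cases hE' with
    | hole =>
      exact absurd (IsEval.eq_hole_of_redex (E := .appL E s) (.appL hE) hr (h ▸ hr')) (by simp)
    | appL hE' =>
      simp only [Ctx.plug, Tm.app.injEq] at h
      obtain ⟨h, rfl⟩ := h
      obtain ⟨rfl, rfl⟩ := ih hE' h
      exact ⟨rfl, rfl⟩
    | appR hv =>
      simp only [Ctx.plug, Tm.app.injEq] at h
      exact absurd (h.1 ▸ hv) (hE.plug_not_value hr)
    | _ => simp [Ctx.plug] at h
  | @appR v E hv hE ih =>
    cases hE' with
    | hole =>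
      exact absurd (IsEval.eq_hole_of_redex (E := .appR v E) (.appR hv hE) hr (h ▸ hr')) (by simp)
    | appR _ hE' =>
      simp only [Ctx.plug, Tm.app.injEq] at h
      obtain ⟨rfl, h⟩ := h
      obtain ⟨rfl, rfl⟩ := ih hE' h
      exact ⟨rfl, rfl⟩
    | appL hE' =>
      simp only [Ctx.plug, Tm.app.injEq] at h
      exact absurd (h.1 ▸ hv) (hE'.plug_not_value hr')
    | _ => simp [Ctx.plug] at h

theorem Red.deterministic {r s s' : Tm} (h : Red r s) (h' : Red r s') : s = s' := by
  cases h <;> cases h' <;>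
    first
    | rfl
    | (exfalso; cases ‹IsTag _› <;> simp_all [Ty.floor])
    | simp_all

theorem Red.not_fails {r s : Tm} (h : Red r s) : ¬ Fails r := by
  intro h'
  cases h <;> cases h' <;>
    first
    | (simp_all [Ty.floor]; done)
    | (rename_i h _ _; cases h <;> simp_all [Ty.floor])

theorem Red.ne_err {r s : Tm} (h : Red r s) : r ≠ .err := by
  rintro rfl; cases h

theorem Fails.ne_err {r : Tm} (h : Fails r) : r ≠ .err := by
  rintro rfl; cases h

theorem Step.deterministic {t s s' : Tm} (h : Step t s) (h' : Step t s') : s = s' := by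
  -- All aborting steps have the same result, so the only conflict to exclude is between a reduction
  -- and an abort.
  have red_abort : ∀ {E E' : Ctx} {r s r' : Tm}, IsEval E → Red r s → IsEval E' →
      (Fails r' ∨ r' = .err) → E.plug r ≠ E'.plug r' := by
    intro E E' r s r' hE hr hE' hr' he
    obtain ⟨rfl, rfl⟩ := unique_decomposition hE hE' (.inl ⟨_, hr⟩) (.inr hr') he
    exact hr'.elim hr.not_fails hr.ne_err
  generalize ht : t = t' at h'
  cases h with
  | red hE hr =>
    cases h' with
    | red hE' hr' =>
      obtain ⟨rfl, rfl⟩ := unique_decomposition hE hE' (.inl ⟨_, hr⟩) (.inl ⟨_, hr'⟩) ht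
      rw [hr.deterministic hr']
    | err hE' => exact absurd ht (red_abort hE hr hE' (.inr rfl))
    | fail hE' hr' => exact absurd ht (red_abort hE hr hE' (.inl hr'))
  | err hE =>
    cases h' with
    | red hE' hr' => exact absurd ht.symm (red_abort hE' hr' hE (.inr rfl))
    | _ => rfl
  | fail hE hr =>
    cases h' with
    | red hE' hr' => exact absurd ht.symm (red_abort hE' hr' hE (.inl hr))
    | _ => rfl

/-- Terms that do not reduce. -/
def Irred (t : Tm) : Prop := ∀ t', ¬ Step t t'

theorem Step.exists_redex {t t' : Tm} (h : Step t t') :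
    ∃ E r, IsEval E ∧ Redex r ∧ t = E.plug r := by
  cases h with
  | red hE hr => exact ⟨_, _, hE, .inl ⟨_, hr⟩, rfl⟩
  | err hE => exact ⟨_, _, hE, .inr (.inr rfl), rfl⟩
  | fail hE hr => exact ⟨_, _, hE, .inr (.inl hr), rfl⟩

theorem Value.irred {v : Tm} (hv : Value v) : Irred v := by
  intro t h
  obtain ⟨E, r, hE, hr, rfl⟩ := h.exists_redex
  exact hE.plug_not_value hr hv

theorem Value.ne_err {v : Tm} (hv : Value v) : v ≠ .err := by
  rintro rfl; cases hv

theorem irred_err : Irred .err := by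
  intro t h
  generalize he : Tm.err = e at h
  have hE : ∀ {E : Ctx} {r : Tm}, IsEval E → Redex r → Tm.err = E.plug r → E = .hole ∧ r = .err :=
    fun hE hr h => by
      obtain ⟨rfl, rfl⟩ := unique_decomposition .hole hE (.inr (.inr rfl)) hr h
      exact ⟨rfl, rfl⟩
  cases h with
  | red h hr => exact hr.ne_err (hE h (.inl ⟨_, hr⟩) he).2
  | err h hne => exact hne (hE h (.inr (.inr rfl)) he).1
  | fail h hr => exact hr.ne_err (hE h (.inr (.inl hr)) he).2

/-- An abort inside `K` discards `K` in the same step, so it never passes through `K.plug .err`. -/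
theorem Step.plug {K : Ctx} (hK : IsEval K) {t t' : Tm} (h : Step t t') :
    Step (K.plug t) (K.plug t') ∨ (t' = .err ∧ Step (K.plug t) .err) := by
  cases h with
  | red hE hr =>
    left
    rw [← Ctx.plug_comp, ← Ctx.plug_comp]
    exact .red (hK.comp hE) hr
  | err hE hne =>
    right
    rw [← Ctx.plug_comp]
    exact ⟨rfl, .err (hK.comp hE) (Ctx.comp_ne_hole hne)⟩
  | fail hE hr =>
    right
    rw [← Ctx.plug_comp]
    exact ⟨rfl, .fail (hK.comp hE) hr⟩

theorem Red.step {r s : Tm} (h : Red r s) : Step r s := .red .hole h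

theorem Fails.step {r : Tm} (h : Fails r) : Step r .err := .fail .hole h

/-! ## Reduction sequences -/

/-- Many-step reduction. -/
abbrev Steps : Tm → Tm → Prop := Relation.ReflTransGen Step

theorem Step.steps {t t' : Tm} (h : Step t t') : Steps t t' := .single h

theorem Irred.eq_of_steps {t u : Tm} (ht : Irred t) (h : Steps t u) : u = t := by
  rcases Relation.ReflTransGen.cases_head h with h | ⟨_, h, _⟩
  · exact h.symm
  · exact absurd h (ht _)

theorem Steps.plug_or {K : Ctx} (hK : IsEval K) {t u : Tm} (h : Steps t u) :
    Steps (K.plug t) (K.plug u) ∨ (u = .err ∧ Steps (K.plug t) .err) := by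
  induction h using Relation.ReflTransGen.head_induction_on with
  | refl => exact .inl .refl
  | head h hs ih =>
    rcases h.plug hK with h' | ⟨rfl, h'⟩
    · exact ih.imp (.head h') (fun ⟨e, hs⟩ => ⟨e, .head h' hs⟩)
    · exact .inr ⟨irred_err.eq_of_steps hs, h'.steps⟩

theorem Steps.plug {K : Ctx} (hK : IsEval K) {t u : Tm} (h : Steps t u) (hu : u ≠ .err) :
    Steps (K.plug t) (K.plug u) :=
  (h.plug_or hK).resolve_right fun h' => hu h'.1

theorem Steps.plug_err {K : Ctx} (hK : IsEval K) {t : Tm} (h : Steps t .err) :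
    Steps (K.plug t) .err := by
  rcases h.plug_or hK with h | h
  · by_cases hne : K = .hole
    · subst hne; exact h
    · exact h.trans (Step.steps (.err hK hne))
  · exact h.2

theorem Steps.unique {t u u' : Tm} (h : Steps t u) (hu : Irred u) (h' : Steps t u')
    (hu' : Irred u') : u = u' := by
  induction h using Relation.ReflTransGen.head_induction_on with
  | refl => exact (hu.eq_of_steps h').symm
  | head h _ ih =>
    rcases Relation.ReflTransGen.cases_head h' with rfl | ⟨_, h₁, h₂⟩
    · exact absurd h (hu' _)
    · exact ih (h.deterministic h₁ ▸ h₂)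

/-- Reduction in a given number of steps. -/
def StepN : ℕ → Tm → Tm → Prop
  | 0, t, u => t = u
  | k + 1, t, u => ∃ t', Step t t' ∧ StepN k t' u

theorem StepN.steps {k : ℕ} {t u : Tm} (h : StepN k t u) : Steps t u := by
  induction k generalizing t with
  | zero => cases h; exact .refl
  | succ k ih => obtain ⟨t', h, h'⟩ := h; exact .head h (ih h')

theorem Steps.exists_stepN {t u : Tm} (h : Steps t u) : ∃ k, StepN k t u := by
  induction h using Relation.ReflTransGen.head_induction_on with
  | refl => exact ⟨0, rfl⟩
  | head h _ ih => obtain ⟨k, hk⟩ := ih; exact ⟨k + 1, _, h, hk⟩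

theorem StepN.suffix {t t' u : Tm} (h : Steps t t') {k : ℕ} (hk : StepN k t u) (hu : Irred u) :
    ∃ i ≤ k, StepN i t' u := by
  induction h using Relation.ReflTransGen.head_induction_on generalizing k with
  | refl => exact ⟨k, le_rfl, hk⟩
  | head h _ ih =>
    cases k with
    | zero => cases hk; exact absurd h (hu _)
    | succ k =>
      obtain ⟨_, h₁, h₂⟩ := hk
      obtain ⟨i, hi, hs⟩ := ih (h₁.deterministic h ▸ h₂)
      exact ⟨i, by omega, hs⟩

/-- By determinism the reduction of `K.plug t` follows that of `t` until the latter halts. The step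
count of the remainder is lost when `t` ends in `err`, where it is not needed. -/
theorem StepN.unplug {K : Ctx} (hK : IsEval K) {k : ℕ} {t u : Tm} (h : StepN k (K.plug t) u)
    (hu : Irred u) :
    ∃ i ≤ k, ∃ s, StepN i t s ∧ Irred s ∧ (s ≠ .err → StepN (k - i) (K.plug s) u) := by
  induction k generalizing t with
  | zero =>
    refine ⟨0, le_rfl, t, rfl, fun t' ht => ?_, fun _ => h⟩
    cases h
    exact (ht.plug hK).elim (hu _) (fun h => hu _ h.2)
  | succ k ih =>
    by_cases ht : Irred t
    · exact ⟨0, by omega, t, rfl, ht, fun _ => h⟩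
    · simp only [Irred, not_forall, not_not] at ht
      obtain ⟨t', ht⟩ := ht
      obtain ⟨x, hx, h⟩ := h
      rcases ht.plug hK with h' | ⟨rfl, h'⟩
      · rw [hx.deterministic h'] at h
        obtain ⟨i, hi, s, h₁, h₂, h₃⟩ := ih h
        exact ⟨i + 1, by omega, s, ⟨t', ht, h₁⟩, h₂, by simpa using h₃⟩
      · exact ⟨1, by omega, .err, ⟨_, ht, rfl⟩, irred_err, fun h => absurd rfl h⟩

theorem exists_steps_irred_or_diverges (t : Tm) :
    (∃ u, Steps t u ∧ Irred u) ∨ Diverges t := by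
  by_cases h : ∃ u, Steps t u ∧ Irred u
  · exact .inl h
  · right
    have hs : ∀ s : {s // Steps t s}, ∃ s' : {s // Steps t s}, Step s.1 s'.1 := by
      rintro ⟨s, hs⟩
      by_contra hn
      exact h ⟨s, hs, fun s' h' => hn ⟨⟨s', hs.tail h'⟩, h'⟩⟩
    choose f hf using hs
    refine ⟨fun n => (f^[n] ⟨t, .refl⟩).1, rfl, fun n => ?_⟩
    simp only [Function.iterate_succ_apply']
    exact hf _

/-! ## Type dynamism without transitivity -/

/-- A syntax-directed presentation of type dynamism. -/
inductive Le : Ty → Ty → Prop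
  | top {A : Ty} : Le A .dyn
  | unit : Le .unit .unit
  | prod {A₁ A₂ B₁ B₂ : Ty} : Le A₁ A₂ → Le B₁ B₂ → Le (.prod A₁ B₁) (.prod A₂ B₂)
  | sum {A₁ A₂ B₁ B₂ : Ty} : Le A₁ A₂ → Le B₁ B₂ → Le (.sum A₁ B₁) (.sum A₂ B₂)
  | arr {A₁ A₂ B₁ B₂ : Ty} : Le A₁ A₂ → Le B₁ B₂ → Le (.arr A₁ B₁) (.arr A₂ B₂)

theorem Le.refl (A : Ty) : Le A A := by
  induction A <;> constructor <;> assumption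

theorem Le.trans {A B C : Ty} (h : Le A B) (h' : Le B C) : Le A C := by
  induction h generalizing C with
  | top => cases h'; exact .top
  | unit => exact h'
  | prod _ _ ih₁ ih₂ | sum _ _ ih₁ ih₂ | arr _ _ ih₁ ih₂ =>
    cases h' <;> constructor <;> first | apply ih₁; assumption | apply ih₂; assumption

/-- Eliminating transitivity makes derivations invertible: their last rule exposes the shape of both
types. -/
theorem TyDyn.le {A B : Ty} (h : TyDyn A B) : Le A B := by
  induction h with
  | refl => exact .refl _
  | trans _ _ h h' => exact h.trans h'
  | top => exact .top
  | sum _ _ h h' => exact .sum h h'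
  | prod _ _ h h' => exact .prod h h'
  | arr _ _ h h' => exact .arr h h'

theorem Le.tyDyn {A B : Ty} (h : Le A B) : TyDyn A B := by
  induction h with
  | top => exact .top
  | unit => exact .refl
  | prod _ _ h h' => exact .prod h h'
  | sum _ _ h h' => exact .sum h h'
  | arr _ _ h h' => exact .arr h h'

theorem Le.eq_dyn {A : Ty} (h : Le .dyn A) : A = .dyn := by cases h; rfl

/-- This is why the right cast passes every tag check that the left cast passes. -/
theorem Le.floor_eq {A B : Ty} (h : Le A B) (hB : B ≠ .dyn) : A.floor = B.floor := by
  cases h <;> first | exact absurd rfl hB | rfl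

theorem Le.floor (A : Ty) : Le A A.floor := by
  cases A <;> constructor <;> exact .top

theorem Le.of_floor_eq {A G : Ty} (h : A.floor = G) : Le A G := h ▸ Le.floor A

/-! ## The logical relation -/

/-- The side of a relation on which reduction steps are counted. -/
inductive Side : Type
  | left : Side
  | right : Side

/-- The component of a pair of terms on the given side. -/
def Side.pick : Side → Tm → Tm → Tm
  | .left, t, _ => t
  | .right, _, t => t

/-- `t₁` fails, or both terms reduce to terms related by `R`. -/
def Result (R : Tm → Tm → Prop) (t₁ t₂ : Tm) : Prop :=
  Steps t₁ .err ∨ ∃ u₁ u₂, Steps t₁ u₁ ∧ Steps t₂ u₂ ∧ R u₁ u₂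

/-- Related values, given a relation `F` on the bodies of functions. -/
inductive ValueRelOver (F : Ty → Ty → Ty → Ty → Tm → Tm → Prop) : Ty → Ty → Tm → Tm → Prop
  | unit : ValueRelOver F .unit .unit .unit .unit
  | pair {A₁ A₂ B₁ B₂ : Ty} {v₁ v₂ w₁ w₂ : Tm} :
      ValueRelOver F A₁ A₂ v₁ v₂ → ValueRelOver F B₁ B₂ w₁ w₂ →
      ValueRelOver F (.prod A₁ B₁) (.prod A₂ B₂) (.pair v₁ w₁) (.pair v₂ w₂)
  | inl {A₁ A₂ B₁ B₂ : Ty} {v₁ v₂ : Tm} : ValueRelOver F A₁ A₂ v₁ v₂ →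
      ValueRelOver F (.sum A₁ B₁) (.sum A₂ B₂) (.inl v₁) (.inl v₂)
  | inr {A₁ A₂ B₁ B₂ : Ty} {v₁ v₂ : Tm} : ValueRelOver F B₁ B₂ v₁ v₂ →
      ValueRelOver F (.sum A₁ B₁) (.sum A₂ B₂) (.inr v₁) (.inr v₂)
  | lam {A₁ A₂ B₁ B₂ C₁ C₂ : Ty} {b₁ b₂ : Tm} : F A₁ A₂ B₁ B₂ b₁ b₂ →
      ValueRelOver F (.arr A₁ B₁) (.arr A₂ B₂) (.lam C₁ b₁) (.lam C₂ b₂)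
  | tag {G : Ty} {v₁ v₂ : Tm} : IsTag G → ValueRelOver F G G v₁ v₂ →
      ValueRelOver F .dyn .dyn (.cast G .dyn v₁) (.cast G .dyn v₂)
  | tagRight {A G : Ty} {v₁ v₂ : Tm} : IsTag G → ValueRelOver F A G v₁ v₂ →
      ValueRelOver F A .dyn v₁ (.cast G .dyn v₂)

theorem ValueRelOver.value {F : Ty → Ty → Ty → Ty → Tm → Tm → Prop} {A₁ A₂ : Ty} {v₁ v₂ : Tm}
    (h : ValueRelOver F A₁ A₂ v₁ v₂) : Value v₁ ∧ Value v₂ := by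
  induction h with
  | unit => exact ⟨.unit, .unit⟩
  | pair _ _ h h' => exact ⟨.pair h.1 h'.1, .pair h.2 h'.2⟩
  | inl _ h => exact ⟨.inl h.1, .inl h.2⟩
  | inr _ h => exact ⟨.inr h.1, .inr h.2⟩
  | lam => exact ⟨.lam, .lam⟩
  | tag hG _ h => exact ⟨.tag hG h.1, .tag hG h.2⟩
  | tagRight hG _ h => exact ⟨h.1, .tag hG h.2⟩

theorem ValueRelOver.mono {F F' : Ty → Ty → Ty → Ty → Tm → Tm → Prop}
    (hF : ∀ A₁ A₂ B₁ B₂ b₁ b₂, F A₁ A₂ B₁ B₂ b₁ b₂ → F' A₁ A₂ B₁ B₂ b₁ b₂)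
    {A₁ A₂ : Ty} {v₁ v₂ : Tm} (h : ValueRelOver F A₁ A₂ v₁ v₂) : ValueRelOver F' A₁ A₂ v₁ v₂ := by
  induction h with
  | unit => exact .unit
  | pair _ _ h h' => exact .pair h h'
  | inl _ h => exact .inl h
  | inr _ h => exact .inr h
  | lam h => exact .lam (hF _ _ _ _ _ _ h)
  | tag hG _ h => exact .tag hG h
  | tagRight hG _ h => exact .tagRight hG h

/-- Values related up to `n` steps on the side `d`. -/
def ValueRel (d : Side) (n : ℕ) : Ty → Ty → Tm → Tm → Prop :=
  ValueRelOver fun A₁ A₂ B₁ B₂ b₁ b₂ => ∀ j, j < n → ∀ w₁ w₂, ValueRel d j A₁ A₂ w₁ w₂ →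
    ∀ k, k ≤ j → ∀ u, StepN k (d.pick (b₁.inst w₁) (b₂.inst w₂)) u → Irred u →
      Result (ValueRel d (j - k) B₁ B₂) (b₁.inst w₁) (b₂.inst w₂)
termination_by n

/-- Terms related up to `n` steps on the side `d`. -/
def TermRel (d : Side) (n : ℕ) (A₁ A₂ : Ty) (t₁ t₂ : Tm) : Prop :=
  ∀ k, k ≤ n → ∀ u, StepN k (d.pick t₁ t₂) u → Irred u → Result (ValueRel d (n - k) A₁ A₂) t₁ t₂

/-- Function bodies related up to `n` steps on the side `d`. -/
def BodyRel (d : Side) (n : ℕ) (A₁ A₂ B₁ B₂ : Ty) (b₁ b₂ : Tm) : Prop :=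
  ∀ j, j < n → ∀ w₁ w₂, ValueRel d j A₁ A₂ w₁ w₂ → TermRel d j B₁ B₂ (b₁.inst w₁) (b₂.inst w₂)

/-- The definition of `ValueRel` has `BodyRel` written out, so that the recursive calls at `j` and
`j - k`, both below `n`, are visible to the termination check. -/
theorem valueRel_eq (d : Side) (n : ℕ) : ValueRel d n = ValueRelOver (BodyRel d n) := by
  rw [ValueRel]; rfl

section

/-! ### Closure of the relation under smaller indices, expansion and evaluation contexts. -/

variable {d : Side} {n m : ℕ} {A₁ A₂ B₁ B₂ : Ty} {t₁ t₂ v₁ v₂ : Tm}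

theorem ValueRel.value (h : ValueRel d n A₁ A₂ v₁ v₂) : Value v₁ ∧ Value v₂ := by
  rw [valueRel_eq] at h; exact ValueRelOver.value h

theorem ValueRel.mono (hm : m ≤ n) (h : ValueRel d n A₁ A₂ v₁ v₂) : ValueRel d m A₁ A₂ v₁ v₂ := by
  rw [valueRel_eq] at h ⊢
  exact ValueRelOver.mono (fun _ _ _ _ _ _ h j hj => h j (hj.trans_le hm)) h

theorem Side.pick_cases {P : Tm → Tm → Prop} (d : Side) {s₁ s₂ : Tm} (h₁ : P t₁ s₁)
    (h₂ : P t₂ s₂) : P (d.pick t₁ t₂) (d.pick s₁ s₂) := by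
  cases d <;> assumption

theorem Result.mono {R S : Tm → Tm → Prop} (hRS : ∀ u₁ u₂, R u₁ u₂ → S u₁ u₂)
    (h : Result R t₁ t₂) : Result S t₁ t₂ :=
  h.imp_right fun ⟨u₁, u₂, h₁, h₂, h⟩ => ⟨u₁, u₂, h₁, h₂, hRS _ _ h⟩

theorem Result.expand {R : Tm → Tm → Prop} {s₁ s₂ : Tm} (h₁ : Steps t₁ s₁) (h₂ : Steps t₂ s₂)
    (h : Result R s₁ s₂) : Result R t₁ t₂ :=
  h.imp h₁.trans fun ⟨u₁, u₂, h₁', h₂', h⟩ => ⟨u₁, u₂, h₁.trans h₁', h₂.trans h₂', h⟩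

theorem Result.termRel (h : Result (ValueRel d n A₁ A₂) t₁ t₂) : TermRel d n A₁ A₂ t₁ t₂ :=
  fun _ _ _ _ _ => h.mono fun _ _ => ValueRel.mono (Nat.sub_le _ _)

theorem ValueRel.termRel (h : ValueRel d n A₁ A₂ v₁ v₂) : TermRel d n A₁ A₂ v₁ v₂ :=
  Result.termRel (.inr ⟨_, _, .refl, .refl, h⟩)

theorem TermRel.of_steps_err (h : Steps t₁ .err) : TermRel d n A₁ A₂ t₁ t₂ :=
  Result.termRel (.inl h)

/-- Determinism makes the reduction that remains after reaching `s₁` or `s₂` no longer than the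
whole one, so the index left over can only grow. -/
theorem TermRel.expand {s₁ s₂ : Tm} (h₁ : Steps t₁ s₁) (h₂ : Steps t₂ s₂)
    (h : TermRel d n A₁ A₂ s₁ s₂) :
    TermRel d n A₁ A₂ t₁ t₂ := by
  intro k hk u hs hu
  obtain ⟨i, hi, hs'⟩ := StepN.suffix (d.pick_cases h₁ h₂) hs hu
  exact ((h i (hi.trans hk) u hs' hu).mono fun _ _ => ValueRel.mono (by omega)).expand h₁ h₂

/-- A genuine step on the counted side buys one unit of index. `Sem.app` spends it, since function
bodies are related only at strictly smaller indices. -/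
theorem TermRel.expand_step {s₁ s₂ : Tm} (h₁ : Step t₁ s₁) (h₂ : Step t₂ s₂)
    (h : ∀ j < n, TermRel d j A₁ A₂ s₁ s₂) : TermRel d n A₁ A₂ t₁ t₂ := by
  intro k hk u hs hu
  have hd : Step (d.pick t₁ t₂) (d.pick s₁ s₂) := d.pick_cases h₁ h₂
  cases k with
  | zero => cases hs; exact absurd hd (hu _)
  | succ k =>
    obtain ⟨x, hx, hs⟩ := hs
    rw [hx.deterministic hd] at hs
    refine ((h (n - 1) (by omega) k (by omega) u hs hu).mono fun _ _ => ValueRel.mono ?_).expand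
      h₁.steps h₂.steps
    omega

theorem Side.pick_plug (d : Side) (K₁ K₂ : Ctx) : ∃ K,
    (IsEval K₁ → IsEval K₂ → IsEval K) ∧
      ∀ t₁ t₂, d.pick (K₁.plug t₁) (K₂.plug t₂) = K.plug (d.pick t₁ t₂) := by
  cases d
  · exact ⟨K₁, fun h _ => h, fun _ _ => rfl⟩
  · exact ⟨K₂, fun _ h => h, fun _ _ => rfl⟩

/-- The `k` steps on the counted side split into `i` for the subterm and `k - i` for the context
around its value, so the continuation is used at index `n - i`. -/
theorem TermRel.bind {K₁ K₂ : Ctx} (hK₁ : IsEval K₁) (hK₂ : IsEval K₂) (h : TermRel d n A₁ A₂ t₁ t₂)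
    (hK : ∀ j ≤ n, ∀ v₁ v₂, ValueRel d j A₁ A₂ v₁ v₂ →
      TermRel d j B₁ B₂ (K₁.plug v₁) (K₂.plug v₂)) :
    TermRel d n B₁ B₂ (K₁.plug t₁) (K₂.plug t₂) := by
  intro k hk u hs hu
  obtain ⟨K, hKe, hKp⟩ := d.pick_plug K₁ K₂
  rw [hKp] at hs
  obtain ⟨i, hi, s, hts, hsi, hsu⟩ := hs.unplug (hKe hK₁ hK₂) hu
  rcases h i (hi.trans hk) s hts hsi with he | ⟨v₁, v₂, h₁, h₂, hv⟩
  · exact .inl (he.plug_err hK₁)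
  · have hd : Value (d.pick v₁ v₂) := by
      cases d; exacts [hv.value.1, hv.value.2]
    -- The counted subterm halts at `s`, a priori possibly stuck; uniqueness of the irreducible
    -- reduct identifies it with the related value.
    have hsv : s = d.pick v₁ v₂ :=
      hts.steps.unique hsi (d.pick_cases h₁ h₂) hd.irred
    subst hsv
    have hsu := hsu hd.ne_err
    rw [← hKp] at hsu
    refine ((hK (n - i) (by omega) v₁ v₂ hv (k - i) (by omega) u hsu hu).mono
      fun _ _ => ValueRel.mono ?_).expand (h₁.plug hK₁ hv.value.1.ne_err)
      (h₂.plug hK₂ hv.value.2.ne_err)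
    omega

theorem Result.plug {R S : Tm → Tm → Prop} {K₁ K₂ : Ctx} (hK₁ : IsEval K₁) (hK₂ : IsEval K₂)
    (hR : ∀ u₁ u₂, R u₁ u₂ → Value u₁ ∧ Value u₂) (h : Result R t₁ t₂)
    (hS : ∀ u₁ u₂, R u₁ u₂ → Result S (K₁.plug u₁) (K₂.plug u₂)) :
    Result S (K₁.plug t₁) (K₂.plug t₂) := by
  rcases h with h | ⟨u₁, u₂, h₁, h₂, h⟩
  · exact .inl (h.plug_err hK₁)
  · have hu := hR _ _ h
    exact (hS _ _ h).expand (h₁.plug hK₁ hu.1.ne_err) (h₂.plug hK₂ hu.2.ne_err)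

/-! ## Casts -/

/-- Contexts that cast from `A` to `B`, where an identity cast may be omitted. -/
inductive OptCast : Ty → Ty → Ctx → Prop
  | cast {A B : Ty} : OptCast A B (.cast A B .hole)
  | id {A : Ty} : OptCast A A .hole

theorem OptCast.isEval {A B : Ty} {K : Ctx} (h : OptCast A B K) : IsEval K := by
  cases h
  exacts [.cast .hole, .hole]

theorem OptCast.steps_dyn {K : Ctx} (h : OptCast .dyn .dyn K) {v : Tm} (hv : Value v) :
    Steps (K.plug v) v := by
  cases h
  exacts [(Red.dynDyn hv).step.steps, .refl]

theorem OptCast.steps_unit {K : Ctx} (h : OptCast .unit .unit K) {v : Tm} (hv : Value v) :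
    Steps (K.plug v) v := by
  cases h
  exacts [(Red.unitUnit hv).step.steps, .refl]

/-- If `A` is itself a tag type, nothing reduces and the inner cast is the omitted identity;
allowing omission in `OptCast` unifies this with the general case. -/
theorem OptCast.steps_up {A : Ty} {K : Ctx} (h : OptCast A .dyn K) (hA : A ≠ .dyn) :
    ∃ K', OptCast A A.floor K' ∧
      ∀ v, Value v → Steps (K.plug v) (.cast A.floor .dyn (K'.plug v)) := by
  cases h with
  | id => exact absurd rfl hA
  | cast =>
    by_cases hf : A.floor = A
    · refine ⟨.hole, ?_, fun v _ => ?_⟩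
      · rw [hf]; exact .id
      · rw [hf]; exact .refl
    · exact ⟨_, .cast, fun v hv => (Red.tagUp hv hA hf).step.steps⟩

theorem OptCast.steps_down {B G : Ty} {K : Ctx} (h : OptCast .dyn B K) (hB : B ≠ .dyn)
    (hG : IsTag G) (hf : B.floor = G) :
    ∃ K', OptCast G B K' ∧ ∀ v, Value v → Steps (K.plug (.cast G .dyn v)) (K'.plug v) := by
  subst hf
  cases h with
  | id => exact absurd rfl hB
  | cast =>
    by_cases hf : B.floor = B
    · rw [hf] at hG ⊢
      exact ⟨.hole, .id, fun v hv => (Red.tagMatch hv hG).step.steps⟩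
    · refine ⟨_, .cast, fun v hv => .head (Red.tagDn (.tag hG hv) hB hf).step (.single ?_)⟩
      exact Step.red (E := .cast B.floor B .hole) (.cast .hole) (.tagMatch hv hG)

theorem OptCast.steps_down_err {B G : Ty} {K : Ctx} (h : OptCast .dyn B K) (hB : B ≠ .dyn)
    (hG : IsTag G) (hf : B.floor ≠ G) {v : Tm} (hv : Value v) :
    Steps (K.plug (.cast G .dyn v)) .err := by
  cases h with
  | id => exact absurd rfl hB
  | cast =>
    have hB' := isTag_floor hB
    by_cases hf' : B.floor = B
    · exact (Fails.tagMismatch hv (hf' ▸ hB') hG (hf' ▸ hf)).step.steps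
    · refine .head (Red.tagDn (.tag hG hv) hB hf').step (.single ?_)
      exact Step.fail (E := .cast B.floor B .hole) (.cast .hole) (.tagMismatch hv hB' hG hf)

theorem OptCast.steps_mismatch {A B : Ty} {K : Ctx} (h : OptCast A B K) (hA : A ≠ .dyn)
    (hB : B ≠ .dyn) (hf : A.floor ≠ B.floor) {v : Tm} (hv : Value v) :
    Steps (K.plug v) .err := by
  cases h with
  | id => exact absurd rfl hf
  | cast => exact (Fails.tagMismatch' hv hA hB hf).step.steps

theorem OptCast.steps_pair {A A' B B' : Ty} {K : Ctx}
    (h : OptCast (.prod A B) (.prod A' B') K) :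
    ∃ K' K'', OptCast A A' K' ∧ OptCast B B' K'' ∧ ∀ v w, Value v → Value w →
      Steps (K.plug (.pair v w)) (.pair (K'.plug v) (K''.plug w)) := by
  cases h with
  | id => exact ⟨_, _, .id, .id, fun _ _ _ _ => .refl⟩
  | cast => exact ⟨_, _, .cast, .cast, fun v w hv hw => (Red.castPair hv hw).step.steps⟩

theorem OptCast.steps_sum {A A' B B' : Ty} {K : Ctx}
    (h : OptCast (.sum A B) (.sum A' B') K) :
    ∃ K' K'', OptCast A A' K' ∧ OptCast B B' K'' ∧ ∀ v, Value v →
      Steps (K.plug (.inl v)) (.inl (K'.plug v)) ∧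
      Steps (K.plug (.inr v)) (.inr (K''.plug v)) := by
  cases h with
  | id => exact ⟨_, _, .id, .id, fun _ _ => ⟨.refl, .refl⟩⟩
  | cast =>
    exact ⟨_, _, .cast, .cast, fun v hv =>
      ⟨(Red.castInl hv).step.steps, (Red.castInr hv).step.steps⟩⟩

/-- Describes a cast function by its behaviour on arguments: domain cast, original body, codomain
cast. A function that is not cast fits the same pattern with both casts omitted. -/
theorem OptCast.steps_lam {A A' B B' : Ty} {K : Ctx} (h : OptCast (.arr A B) (.arr A' B') K)
    (C : Ty) (b : Tm) :
    ∃ Kd Kc C' b', OptCast A' A Kd ∧ OptCast B B' Kc ∧ Steps (K.plug (.lam C b)) (.lam C' b') ∧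
      ∀ w, Value w → (Steps (Kd.plug w) .err → Steps (b'.inst w) .err) ∧
        ∀ u, Value u → Steps (Kd.plug w) u → Steps (b'.inst w) (Kc.plug (b.inst u)) := by
  cases h with
  | id =>
    refine ⟨.hole, .hole, C, b, .id, .id, .refl, fun w hw => ⟨fun h => ?_, fun u _ h => ?_⟩⟩
    · exact absurd (hw.irred.eq_of_steps h).symm hw.ne_err
    · rw [hw.irred.eq_of_steps h]; exact .refl
  | cast =>
    refine ⟨_, _, _, _, .cast, .cast, (Red.castFun .lam).step.steps, fun w hw => ?_⟩
    have hb : Tm.inst (.cast B B' (.app ((Tm.lam C b).rename Nat.succ) (.cast A' A (.var 0)))) w =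
        .cast B B' (.app (.lam C b) (.cast A' A w)) := by
      have := Tm.rename_succ_inst (.lam C b) w
      rw [Tm.inst] at this
      simp only [Tm.inst, Tm.subst, this, consSub]
    have hK : IsEval (.cast B B' (.appR (.lam C b) .hole)) := .cast (.appR .lam .hole)
    rw [hb]
    refine ⟨fun h => Steps.plug_err hK h, fun u hu h => ?_⟩
    refine (Steps.plug hK h hu.ne_err).tail ?_
    exact Step.red (E := .cast B B' .hole) (.cast .hole) (.beta hu)

/-- Nesting depth of a type, ignoring the dynamic type. -/
def Ty.height : Ty → ℕ
  | .dyn => 0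
  | .unit => 1
  | .prod A B => max A.height B.height + 1
  | .sum A B => max A.height B.height + 1
  | .arr A B => max A.height B.height + 1

/-- Casts from `A₁` to `B₁` and from `A₂` to `B₂` preserve the logical relation. -/
def CastRel (d : Side) (A₁ A₂ B₁ B₂ : Ty) : Prop :=
  ∀ n v₁ v₂ K₁ K₂, ValueRel d n A₁ A₂ v₁ v₂ → OptCast A₁ B₁ K₁ → OptCast A₂ B₂ K₂ →
    Result (ValueRel d n B₁ B₂) (K₁.plug v₁) (K₂.plug v₂)

section Structural

variable {A₁' A₂' B₁' B₂' : Ty}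

theorem castRel_unit : CastRel d .unit .unit .unit .unit := by
  intro n v₁ v₂ K₁ K₂ hv h₁ h₂
  exact .inr ⟨_, _, h₁.steps_unit hv.value.1, h₂.steps_unit hv.value.2, hv⟩

theorem castRel_prod (h : CastRel d A₁ A₂ B₁ B₂) (h' : CastRel d A₁' A₂' B₁' B₂') :
    CastRel d (.prod A₁ A₁') (.prod A₂ A₂') (.prod B₁ B₁') (.prod B₂ B₂') := by
  intro n v₁ v₂ K₁ K₂ hv h₁ h₂
  rw [valueRel_eq] at hv
  cases hv with | @pair _ _ _ _ v₁ v₂ w₁ w₂ hv hw =>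
  rw [← valueRel_eq] at hv hw
  obtain ⟨K₁, K₁', h₁, h₁', hs₁⟩ := h₁.steps_pair
  obtain ⟨K₂, K₂', h₂, h₂', hs₂⟩ := h₂.steps_pair
  refine Result.expand (hs₁ _ _ hv.value.1 hw.value.1) (hs₂ _ _ hv.value.2 hw.value.2) ?_
  refine Result.plug (K₁ := .pairL .hole _) (K₂ := .pairL .hole _) (.pairL .hole) (.pairL .hole)
    (fun _ _ => ValueRel.value) (h n _ _ _ _ hv h₁ h₂) fun u₁ u₂ hu => ?_
  refine Result.plug (K₁ := .pairR u₁ .hole) (K₂ := .pairR u₂ .hole) (.pairR hu.value.1 .hole)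
    (.pairR hu.value.2 .hole) (fun _ _ => ValueRel.value) (h' n _ _ _ _ hw h₁' h₂')
    fun u₁' u₂' hu' => ?_
  refine .inr ⟨_, _, .refl, .refl, ?_⟩
  rw [valueRel_eq] at hu hu' ⊢
  exact .pair hu hu'

theorem castRel_sum (h : CastRel d A₁ A₂ B₁ B₂) (h' : CastRel d A₁' A₂' B₁' B₂') :
    CastRel d (.sum A₁ A₁') (.sum A₂ A₂') (.sum B₁ B₁') (.sum B₂ B₂') := by
  intro n v₁ v₂ K₁ K₂ hv h₁ h₂
  rw [valueRel_eq] at hv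
  obtain ⟨K₁, K₁', h₁, h₁', hs₁⟩ := h₁.steps_sum
  obtain ⟨K₂, K₂', h₂, h₂', hs₂⟩ := h₂.steps_sum
  cases hv with
  | inl hv =>
    rw [← valueRel_eq] at hv
    refine Result.expand (hs₁ _ hv.value.1).1 (hs₂ _ hv.value.2).1 ?_
    refine Result.plug (K₁ := .inl .hole) (K₂ := .inl .hole) (.inl .hole) (.inl .hole)
      (fun _ _ => ValueRel.value) (h n _ _ _ _ hv h₁ h₂) fun u₁ u₂ hu =>
        .inr ⟨_, _, .refl, .refl, ?_⟩
    rw [valueRel_eq] at hu ⊢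
    exact .inl hu
  | inr hv =>
    rw [← valueRel_eq] at hv
    refine Result.expand (hs₁ _ hv.value.1).2 (hs₂ _ hv.value.2).2 ?_
    refine Result.plug (K₁ := .inr .hole) (K₂ := .inr .hole) (.inr .hole) (.inr .hole)
      (fun _ _ => ValueRel.value) (h' n _ _ _ _ hv h₁' h₂') fun u₁ u₂ hu =>
        .inr ⟨_, _, .refl, .refl, ?_⟩
    rw [valueRel_eq] at hu ⊢
    exact .inr hu

/-- The domain cast runs backwards, but monotonicity of `→` in both arguments for `⊑` makes the
reversed square one of the same kind. A failing left domain cast makes the left call fail, which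
settles that call. -/
theorem castRel_arr (h : CastRel d B₁ B₂ A₁ A₂) (h' : CastRel d A₁' A₂' B₁' B₂') :
    CastRel d (.arr A₁ A₁') (.arr A₂ A₂') (.arr B₁ B₁') (.arr B₂ B₂') := by
  intro n v₁ v₂ K₁ K₂ hv h₁ h₂
  rw [valueRel_eq] at hv
  cases hv with | lam hb =>
  obtain ⟨Kd₁, Kc₁, _, _, hd₁, hc₁, hs₁, hb₁⟩ := h₁.steps_lam _ _
  obtain ⟨Kd₂, Kc₂, _, _, hd₂, hc₂, hs₂, hb₂⟩ := h₂.steps_lam _ _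
  refine .inr ⟨_, _, hs₁, hs₂, ?_⟩
  rw [valueRel_eq]
  refine .lam fun j hj w₁ w₂ hw => ?_
  obtain ⟨he, hb₁⟩ := hb₁ w₁ hw.value.1
  have hb₂ := (hb₂ w₂ hw.value.2).2
  rcases h j _ _ _ _ hw hd₁ hd₂ with hf | ⟨u₁, u₂, hu₁, hu₂, hu⟩
  · exact .of_steps_err (he hf)
  · refine TermRel.expand (hb₁ _ hu.value.1 hu₁) (hb₂ _ hu.value.2 hu₂) ?_
    exact (hb j hj _ _ hu).bind hc₁.isEval hc₂.isEval fun i _ x₁ x₂ hx =>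
      (h' i _ _ _ _ hx hc₁ hc₂).termRel

end Structural

/-- With no `?` on the right, both `A₁`, `A₂` and `B₁`, `B₂` agree in their outermost constructors.
Either the left cast fails its tag comparison, or all four constructors agree and the components are
smaller. -/
theorem castRel_of_ne_dyn {N : ℕ} (hN : ∀ A₁ A₂ B₁ B₂ : Ty, A₁.height < N → A₂.height < N →
      B₁.height < N → B₂.height < N → Le A₁ A₂ → Le B₁ B₂ → CastRel d A₁ A₂ B₁ B₂)
    (hA₁ : A₁.height ≤ N) (hA₂ : A₂.height ≤ N) (hB₁ : B₁.height ≤ N) (hB₂ : B₂.height ≤ N)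
    (hA : Le A₁ A₂) (hB : Le B₁ B₂) (hA₂' : A₂ ≠ .dyn) (hB₂' : B₂ ≠ .dyn) :
    CastRel d A₁ A₂ B₁ B₂ := by
  by_cases hf : A₁.floor = B₁.floor
  · cases hA <;> cases hB <;> simp only [Ty.floor, reduceCtorEq, ne_eq, not_true_eq_false] at * <;>
      simp only [Ty.height] at hA₁ hA₂ hB₁ hB₂
    · exact castRel_unit
    · apply castRel_prod <;> apply hN <;> first | assumption | omega
    · apply castRel_sum <;> apply hN <;> first | assumption | omega
    · apply castRel_arr <;> apply hN <;> first | assumption | omega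
  · intro n v₁ v₂ K₁ K₂ hv h₁ _
    refine .inl (h₁.steps_mismatch ?_ ?_ hf hv.value.1)
    · rintro rfl; exact hA₂' hA.eq_dyn
    · rintro rfl; exact hB₂' hB.eq_dyn

theorem Ty.height_pos {A : Ty} (h : A ≠ .dyn) : 0 < A.height := by
  cases A <;> simp_all [Ty.height]

theorem IsTag.height_eq {G : Ty} (h : IsTag G) : G.height = 1 := by
  cases h <;> rfl

/-- `tagRight` cannot apply here: its premise would relate a value at `?` to one at a tag type. -/
theorem ValueRel.dyn_dyn_inv (h : ValueRel d n .dyn .dyn v₁ v₂) :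
    ∃ G w₁ w₂, IsTag G ∧ ValueRel d n G G w₁ w₂ ∧
    v₁ = .cast G .dyn w₁ ∧ v₂ = .cast G .dyn w₂ := by
  rw [valueRel_eq] at h ⊢
  cases h with
  | tag hG h => exact ⟨_, _, _, hG, h, rfl, rfl⟩
  | tagRight hG h => cases h <;> cases hG

theorem ValueRel.floor_eq (h : ValueRel d n A₁ A₂ v₁ v₂) (hA₂ : A₂ ≠ .dyn) :
    A₁.floor = A₂.floor := by
  rw [valueRel_eq] at h
  cases h <;> first | rfl | exact absurd rfl hA₂

theorem ValueRel.right_dyn_inv (h : ValueRel d n A₁ .dyn v₁ v₂) (hA₁ : A₁ ≠ .dyn) :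
    ∃ w₂, ValueRel d n A₁ A₁.floor v₁ w₂ ∧ v₂ = .cast A₁.floor .dyn w₂ := by
  rw [valueRel_eq] at h
  cases h with
  | tag hG h => exact absurd rfl hA₁
  | tagRight hG h =>
    rw [← valueRel_eq] at h
    rw [h.floor_eq hG.ne_dyn, hG.floor_eq]
    exact ⟨_, h, rfl⟩

theorem Result.tagRight {G : Ty} (hG : IsTag G) (h : Result (ValueRel d n A₁ G) t₁ t₂) :
    Result (ValueRel d n A₁ .dyn) t₁ (.cast G .dyn t₂) := by
  refine Result.plug (K₁ := .hole) (K₂ := .cast G .dyn .hole) .hole (.cast .hole)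
    (fun _ _ => ValueRel.value) h fun u₁ u₂ hu => .inr ⟨_, _, .refl, .refl, ?_⟩
  rw [valueRel_eq] at hu ⊢
  exact .tagRight hG hu

theorem Result.tag {G : Ty} (hG : IsTag G) (h : Result (ValueRel d n G G) t₁ t₂) :
    Result (ValueRel d n .dyn .dyn) (.cast G .dyn t₁) (.cast G .dyn t₂) := by
  refine Result.plug (K₁ := .cast G .dyn .hole) (K₂ := .cast G .dyn .hole) (.cast .hole)
    (.cast .hole) (fun _ _ => ValueRel.value) h fun u₁ u₂ hu => .inr ⟨_, _, .refl, .refl, ?_⟩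
  rw [valueRel_eq] at hu ⊢
  exact .tag hG hu

/-- A `?` on the right is replaced by a tag type: on the source side by stripping the tag that the
value carries, on the target side by setting aside the tag to be added. This reduces to
`castRel_of_ne_dyn`, unless the left cast fails or both casts are from `?` to `?`. -/
theorem castRel_of_height (N : ℕ) : ∀ A₁ A₂ B₁ B₂ : Ty, A₁.height ≤ N → A₂.height ≤ N →
    B₁.height ≤ N → B₂.height ≤ N → Le A₁ A₂ → Le B₁ B₂ → CastRel d A₁ A₂ B₁ B₂ := by
  induction N using Nat.strong_induction_on with | _ N ih =>
  intro A₁ A₂ B₁ B₂ hA₁ hA₂ hB₁ hB₂ hA hB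
  have struct : ∀ {A₁ A₂ B₁ B₂ : Ty}, A₁.height ≤ N → A₂.height ≤ N → B₁.height ≤ N →
      B₂.height ≤ N → Le A₁ A₂ → Le B₁ B₂ → A₂ ≠ .dyn → B₂ ≠ .dyn → CastRel d A₁ A₂ B₁ B₂ :=
    castRel_of_ne_dyn fun A₁ A₂ B₁ B₂ h₁ h₂ h₃ h₄ hA hB =>
      ih (N - 1) (by omega) A₁ A₂ B₁ B₂ (by omega) (by omega) (by omega) (by omega) hA hB
  -- Tag types have height 1, the least height of a non-dynamic type, so the replacement stays
  -- within `N`.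
  have tag_le : ∀ {A : Ty}, A ≠ .dyn → A.height ≤ N → A.floor.height ≤ N := fun hA h => by
    rw [(isTag_floor hA).height_eq]
    exact (Ty.height_pos hA).trans_le h
  intro n v₁ v₂ K₁ K₂ hv h₁ h₂
  obtain ⟨hv₁, hv₂⟩ := hv.value
  by_cases hA₂d : A₂ = .dyn
  · subst hA₂d
    by_cases hA₁d : A₁ = .dyn
    · subst hA₁d
      obtain ⟨G, w₁, w₂, hG, hw, rfl, rfl⟩ := hv.dyn_dyn_inv
      obtain ⟨hw₁, hw₂⟩ := hw.value
      by_cases hB₁d : B₁ = .dyn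
      · subst hB₁d
        obtain rfl := hB.eq_dyn
        exact .inr ⟨_, _, h₁.steps_dyn hv₁, h₂.steps_dyn hv₂, hv⟩
      by_cases hf : B₁.floor = G
      · obtain ⟨K₁, h₁, hs₁⟩ := h₁.steps_down hB₁d hG hf
        have hGN : G.height ≤ N := hf ▸ tag_le hB₁d hB₁
        by_cases hB₂d : B₂ = .dyn
        · subst hB₂d
          -- Only the left cast inspects the payload. The right one keeps its tag, and its payload
          -- counts as cast from `G` to `G` with the cast omitted.
          refine Result.expand (hs₁ _ hw₁) (h₂.steps_dyn hv₂) (.tagRight hG ?_)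
          exact struct hGN hGN hB₁ hGN (.refl _) (.of_floor_eq hf) hG.ne_dyn hG.ne_dyn n _ _ _
            .hole hw h₁ .id
        · obtain ⟨K₂, h₂, hs₂⟩ := h₂.steps_down hB₂d hG (hB.floor_eq hB₂d ▸ hf)
          refine Result.expand (hs₁ _ hw₁) (hs₂ _ hw₂) ?_
          exact struct hGN hGN hB₁ hB₂ (.refl _) hB hG.ne_dyn hB₂d n _ _ _ _ hw h₁ h₂
      · exact .inl (h₁.steps_down_err hB₁d hG hf hw₁)
    · obtain ⟨w₂, hw, rfl⟩ := hv.right_dyn_inv hA₁d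
      have hG := isTag_floor hA₁d
      have hGN := tag_le hA₁d hA₁
      have hw₂ := hw.value.2
      by_cases hB₁d : B₁ = .dyn
      · subst hB₁d
        obtain rfl := hB.eq_dyn
        obtain ⟨K₁, h₁, hs₁⟩ := h₁.steps_up hA₁d
        refine Result.expand (hs₁ _ hv₁) (h₂.steps_dyn hv₂) (.tag hG ?_)
        exact struct hA₁ hGN hGN hGN (.floor _) (.refl _) hG.ne_dyn hG.ne_dyn n _ _ _ .hole hw h₁
          .id
      by_cases hf : A₁.floor = B₁.floor
      · by_cases hB₂d : B₂ = .dyn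
        · subst hB₂d
          refine Result.expand .refl (h₂.steps_dyn hv₂) (.tagRight hG ?_)
          exact struct hA₁ hGN hB₁ hGN (.floor _) (.of_floor_eq hf.symm) hG.ne_dyn hG.ne_dyn n _ _
            _ .hole hw h₁ .id
        · obtain ⟨K₂, h₂, hs₂⟩ := h₂.steps_down hB₂d hG ((hB.floor_eq hB₂d).symm.trans hf.symm)
          refine Result.expand .refl (hs₂ _ hw₂) ?_
          exact struct hA₁ hGN hB₁ hB₂ (.floor _) hB hG.ne_dyn hB₂d n _ _ _ _ hw h₁ h₂
      · exact .inl (h₁.steps_mismatch hA₁d hB₁d hf hv₁)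
  · have hA₁d : A₁ ≠ .dyn := by
      rintro rfl; exact hA₂d hA.eq_dyn
    have hfA := hA.floor_eq hA₂d
    by_cases hB₂d : B₂ = .dyn
    · subst hB₂d
      have hG := isTag_floor hA₂d
      have hGN := tag_le hA₂d hA₂
      obtain ⟨K₂, h₂, hs₂⟩ := h₂.steps_up hA₂d
      by_cases hB₁d : B₁ = .dyn
      · subst hB₁d
        obtain ⟨K₁, h₁, hs₁⟩ := h₁.steps_up hA₁d
        rw [hfA] at h₁ hs₁
        refine Result.expand (hs₁ _ hv₁) (hs₂ _ hv₂) (.tag hG ?_)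
        exact struct hA₁ hA₂ hGN hGN hA (.refl _) hA₂d hG.ne_dyn n _ _ _ _ hv h₁ h₂
      by_cases hf : A₁.floor = B₁.floor
      · refine Result.expand .refl (hs₂ _ hv₂) (.tagRight hG ?_)
        exact struct hA₁ hA₂ hB₁ hGN hA (.of_floor_eq (hf.symm.trans hfA)) hA₂d hG.ne_dyn n _ _ _ _
          hv h₁ h₂
      · exact .inl (h₁.steps_mismatch hA₁d hB₁d hf hv₁)
    · exact struct hA₁ hA₂ hB₁ hB₂ hA hB hA₂d hB₂d n _ _ _ _ hv h₁ h₂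

theorem castRel (hA : Le A₁ A₂) (hB : Le B₁ B₂) : CastRel d A₁ A₂ B₁ B₂ :=
  castRel_of_height (max (max A₁.height A₂.height) (max B₁.height B₂.height)) _ _ _ _
    (by omega) (by omega) (by omega) (by omega) hA hB

end

/-! ## Semantic term dynamism -/

/-- Substitutions related up to `n` steps. -/
def SubstRel (d : Side) (n : ℕ) (Γ₁ Γ₂ : Env) (γ₁ γ₂ : ℕ → Tm) : Prop :=
  ∀ i A₁ A₂, Γ₁[i]? = some A₁ → Γ₂[i]? = some A₂ → ValueRel d n A₁ A₂ (γ₁ i) (γ₂ i)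

/-- Semantic term dynamism. -/
def Sem (Γ₁ Γ₂ : Env) (t₁ t₂ : Tm) (A₁ A₂ : Ty) : Prop :=
  ∀ d n γ₁ γ₂, SubstRel d n Γ₁ Γ₂ γ₁ γ₂ → TermRel d n A₁ A₂ (t₁.subst γ₁) (t₂.subst γ₂)

section Compatibility

variable {d : Side} {n m : ℕ} {Γ₁ Γ₂ : Env} {γ₁ γ₂ : ℕ → Tm} {A₁ A₂ A₁' A₂' B₁ B₂ : Ty}
  {t₁ t₂ s₁ s₂ s₁' s₂' v₁ v₂ : Tm}

theorem SubstRel.mono (hm : m ≤ n) (h : SubstRel d n Γ₁ Γ₂ γ₁ γ₂) : SubstRel d m Γ₁ Γ₂ γ₁ γ₂ :=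
  fun i A₁ A₂ h₁ h₂ => (h i A₁ A₂ h₁ h₂).mono hm

theorem SubstRel.cons (h : SubstRel d n Γ₁ Γ₂ γ₁ γ₂) (hv : ValueRel d n A₁ A₂ v₁ v₂) :
    SubstRel d n (A₁ :: Γ₁) (A₂ :: Γ₂) (consSub v₁ γ₁) (consSub v₂ γ₂) := by
  intro i B₁ B₂ h₁ h₂
  cases i with
  | zero =>
    simp only [List.getElem?_cons_zero, Option.some.injEq] at h₁ h₂
    subst h₁ h₂
    exact hv
  | succ i => exact h i B₁ B₂ (by simpa using h₁) (by simpa using h₂)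

theorem Sem.err : Sem Γ₁ Γ₂ .err t₂ A₁ A₂ := fun _ _ _ _ _ => .of_steps_err .refl

theorem Sem.var {i : ℕ} (h₁ : Γ₁[i]? = some A₁) (h₂ : Γ₂[i]? = some A₂) :
    Sem Γ₁ Γ₂ (.var i) (.var i) A₁ A₂ := fun _ _ _ _ hγ => (hγ i A₁ A₂ h₁ h₂).termRel

theorem Sem.unit : Sem Γ₁ Γ₂ .unit .unit .unit .unit := fun d n _ _ _ =>
  ValueRel.termRel (by rw [valueRel_eq]; exact .unit)

theorem Sem.cast (h : Sem Γ₁ Γ₂ t₁ t₂ A₁ A₂) (hA : Le A₁ A₂) (hB : Le B₁ B₂) :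
    Sem Γ₁ Γ₂ (.cast A₁ B₁ t₁) (.cast A₂ B₂ t₂) B₁ B₂ := fun d n γ₁ γ₂ hγ =>
  (h d n γ₁ γ₂ hγ).bind (K₁ := .cast A₁ B₁ .hole) (K₂ := .cast A₂ B₂ .hole) (.cast .hole)
    (.cast .hole) fun j _ _ _ hv => (castRel hA hB j _ _ _ _ hv .cast .cast).termRel

theorem Sem.pair (h : Sem Γ₁ Γ₂ t₁ t₂ A₁ A₂) (h' : Sem Γ₁ Γ₂ s₁ s₂ A₁' A₂') :
    Sem Γ₁ Γ₂ (.pair t₁ s₁) (.pair t₂ s₂) (.prod A₁ A₁') (.prod A₂ A₂') := fun d n γ₁ γ₂ hγ =>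
  (h d n γ₁ γ₂ hγ).bind (K₁ := .pairL .hole _) (K₂ := .pairL .hole _) (.pairL .hole)
    (.pairL .hole) fun j hj v₁ v₂ hv =>
  (h' d j γ₁ γ₂ (hγ.mono hj)).bind (K₁ := .pairR v₁ .hole) (K₂ := .pairR v₂ .hole)
    (.pairR hv.value.1 .hole) (.pairR hv.value.2 .hole) fun i hi w₁ w₂ hw => ValueRel.termRel (by
      have hv := hv.mono hi
      rw [valueRel_eq] at hv hw ⊢
      exact .pair hv hw)

theorem Sem.letPair (h : Sem Γ₁ Γ₂ t₁ t₂ (.prod A₁ A₁') (.prod A₂ A₂'))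
    (h' : Sem (A₁' :: A₁ :: Γ₁) (A₂' :: A₂ :: Γ₂) s₁ s₂ B₁ B₂) :
    Sem Γ₁ Γ₂ (.letPair t₁ s₁) (.letPair t₂ s₂) B₁ B₂ := fun d n γ₁ γ₂ hγ =>
  (h d n γ₁ γ₂ hγ).bind (K₁ := .letPairL .hole _) (K₂ := .letPairL .hole _) (.letPair .hole)
    (.letPair .hole) fun j hj v₁ v₂ hv => by
  rw [valueRel_eq] at hv
  cases hv with | pair hv hw =>
  rw [← valueRel_eq] at hv hw
  have := h' d j _ _ (((hγ.mono hj).cons hv).cons hw)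
  rw [← Tm.subst_liftSub_inst₂, ← Tm.subst_liftSub_inst₂] at this
  exact this.expand (Red.letPair hv.value.1 hw.value.1).step.steps
    (Red.letPair hv.value.2 hw.value.2).step.steps

theorem Sem.inl (h : Sem Γ₁ Γ₂ t₁ t₂ A₁ A₂) :
    Sem Γ₁ Γ₂ (.inl t₁) (.inl t₂) (.sum A₁ A₁') (.sum A₂ A₂') := fun d n γ₁ γ₂ hγ =>
  (h d n γ₁ γ₂ hγ).bind (K₁ := .inl .hole) (K₂ := .inl .hole) (.inl .hole) (.inl .hole)
    fun j _ v₁ v₂ hv => ValueRel.termRel (by rw [valueRel_eq] at hv ⊢; exact .inl hv)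

theorem Sem.inr (h : Sem Γ₁ Γ₂ t₁ t₂ A₁' A₂') :
    Sem Γ₁ Γ₂ (.inr t₁) (.inr t₂) (.sum A₁ A₁') (.sum A₂ A₂') := fun d n γ₁ γ₂ hγ =>
  (h d n γ₁ γ₂ hγ).bind (K₁ := .inr .hole) (K₂ := .inr .hole) (.inr .hole) (.inr .hole)
    fun j _ v₁ v₂ hv => ValueRel.termRel (by rw [valueRel_eq] at hv ⊢; exact .inr hv)

theorem Sem.case (h : Sem Γ₁ Γ₂ t₁ t₂ (.sum A₁ A₁') (.sum A₂ A₂'))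
    (hs : Sem (A₁ :: Γ₁) (A₂ :: Γ₂) s₁ s₂ B₁ B₂)
    (hs' : Sem (A₁' :: Γ₁) (A₂' :: Γ₂) s₁' s₂' B₁ B₂) :
    Sem Γ₁ Γ₂ (.case t₁ s₁ s₁') (.case t₂ s₂ s₂') B₁ B₂ := fun d n γ₁ γ₂ hγ =>
  (h d n γ₁ γ₂ hγ).bind (K₁ := .case₀ .hole _ _) (K₂ := .case₀ .hole _ _) (.case .hole)
    (.case .hole) fun j hj v₁ v₂ hv => by
  rw [valueRel_eq] at hv
  cases hv with
  | inl hv =>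
    rw [← valueRel_eq] at hv
    have := hs d j _ _ ((hγ.mono hj).cons hv)
    rw [← Tm.subst_liftSub_inst, ← Tm.subst_liftSub_inst] at this
    exact this.expand (Red.caseInl hv.value.1).step.steps (Red.caseInl hv.value.2).step.steps
  | inr hv =>
    rw [← valueRel_eq] at hv
    have := hs' d j _ _ ((hγ.mono hj).cons hv)
    rw [← Tm.subst_liftSub_inst, ← Tm.subst_liftSub_inst] at this
    exact this.expand (Red.caseInr hv.value.1).step.steps (Red.caseInr hv.value.2).step.steps

theorem Sem.lam {C₁ C₂ : Ty} (h : Sem (A₁ :: Γ₁) (A₂ :: Γ₂) t₁ t₂ B₁ B₂) :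
    Sem Γ₁ Γ₂ (.lam C₁ t₁) (.lam C₂ t₂) (.arr A₁ B₁) (.arr A₂ B₂) := fun d n γ₁ γ₂ hγ => by
  refine ValueRel.termRel ?_
  rw [valueRel_eq]
  refine .lam fun j hj w₁ w₂ hw => ?_
  rw [Tm.subst_liftSub_inst, Tm.subst_liftSub_inst]
  exact h d j _ _ ((hγ.mono hj.le).cons hw)

theorem Sem.app (h : Sem Γ₁ Γ₂ t₁ t₂ (.arr A₁ B₁) (.arr A₂ B₂))
    (h' : Sem Γ₁ Γ₂ s₁ s₂ A₁ A₂) : Sem Γ₁ Γ₂ (.app t₁ s₁) (.app t₂ s₂) B₁ B₂ :=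
  fun d n γ₁ γ₂ hγ =>
  (h d n γ₁ γ₂ hγ).bind (K₁ := .appL .hole _) (K₂ := .appL .hole _) (.appL .hole)
    (.appL .hole) fun j hj v₁ v₂ hv =>
  (h' d j γ₁ γ₂ (hγ.mono hj)).bind (K₁ := .appR v₁ .hole) (K₂ := .appR v₂ .hole)
    (.appR hv.value.1 .hole) (.appR hv.value.2 .hole) fun i hi w₁ w₂ hw => by
  rw [valueRel_eq] at hv
  cases hv with | lam hb =>
  exact TermRel.expand_step (Red.beta hw.value.1).step (Red.beta hw.value.2).step fun k hk =>
    hb k (hk.trans_le hi) _ _ (hw.mono hk.le)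

end Compatibility

/-! ### From syntactic to semantic dynamism. -/

theorem TmDyn.ty_le {Γ₁ Γ₂ : Env} {t₁ t₂ : Tm} {A₁ A₂ : Ty} (h : TmDyn Γ₁ Γ₂ t₁ t₂ A₁ A₂) :
    EnvDyn Γ₁ Γ₂ ∧ TyDyn A₁ A₂ := by
  have arr_inv : ∀ {A₁ A₂ B₁ B₂}, TyDyn (.arr A₁ B₁) (.arr A₂ B₂) → TyDyn B₁ B₂ := by
    intro A₁ A₂ B₁ B₂ h
    cases h.le with | arr _ h => exact h.tyDyn
  induction h with
  | cast _ hB ih => exact ⟨ih.1, hB⟩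
  | var hΓ h₁ h₂ =>
    obtain ⟨hi₁, rfl⟩ := List.getElem?_eq_some_iff.1 h₁
    obtain ⟨hi₂, rfl⟩ := List.getElem?_eq_some_iff.1 h₂
    exact ⟨hΓ, hΓ.get hi₁ hi₂⟩
  | unit hΓ => exact ⟨hΓ, .refl⟩
  | pair _ _ ih ih' => exact ⟨ih.1, .prod ih.2 ih'.2⟩
  | letPair _ _ ih ih' => exact ⟨ih.1, ih'.2⟩
  | inl _ h ih => exact ⟨ih.1, .sum ih.2 h⟩
  | inr _ h ih => exact ⟨ih.1, .sum h ih.2⟩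
  | case _ _ _ ih ih' _ => exact ⟨ih.1, ih'.2⟩
  | lam _ ih =>
    rw [EnvDyn, List.forall₂_cons] at ih
    exact ⟨ih.1.2, .arr ih.1.1 ih.2⟩
  | app _ _ ih _ => exact ⟨ih.1, arr_inv ih.2⟩

theorem TmDyn.hasType {Γ₁ Γ₂ : Env} {t₁ t₂ : Tm} {A₁ A₂ : Ty} (h : TmDyn Γ₁ Γ₂ t₁ t₂ A₁ A₂) :
    HasType Γ₁ t₁ A₁ ∧ HasType Γ₂ t₂ A₂ := by
  induction h with
  | cast _ _ ih => exact ⟨.cast ih.1, .cast ih.2⟩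
  | var _ h₁ h₂ => exact ⟨.var h₁, .var h₂⟩
  | unit => exact ⟨.unit, .unit⟩
  | pair _ _ ih ih' => exact ⟨.pair ih.1 ih'.1, .pair ih.2 ih'.2⟩
  | letPair _ _ ih ih' => exact ⟨.letPair ih.1 ih'.1, .letPair ih.2 ih'.2⟩
  | inl _ _ ih => exact ⟨.inl ih.1, .inl ih.2⟩
  | inr _ _ ih => exact ⟨.inr ih.1, .inr ih.2⟩
  | case _ _ _ ih ih' ih'' => exact ⟨.case ih.1 ih'.1 ih''.1, .case ih.2 ih'.2 ih''.2⟩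
  | lam _ ih => exact ⟨.lam ih.1, .lam ih.2⟩
  | app _ _ ih ih' => exact ⟨.app ih.1 ih'.1, .app ih.2 ih'.2⟩

theorem TmDyn.sem {Γ₁ Γ₂ : Env} {t₁ t₂ : Tm} {A₁ A₂ : Ty} (h : TmDyn Γ₁ Γ₂ t₁ t₂ A₁ A₂) :
    Sem Γ₁ Γ₂ t₁ t₂ A₁ A₂ := by
  induction h with
  | cast h hB ih => exact ih.cast h.ty_le.2.le hB.le
  | var _ h₁ h₂ => exact .var h₁ h₂
  | unit => exact .unit
  | pair _ _ ih ih' => exact ih.pair ih'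
  | letPair _ _ ih ih' => exact ih.letPair ih'
  | inl _ _ ih => exact ih.inl
  | inr _ _ ih => exact ih.inr
  | case _ _ _ ih ih' ih'' => exact ih.case ih' ih''
  | lam _ ih => exact ih.lam
  | app _ _ ih ih' => exact ih.app ih'

/-- Needed for the parts of a program context beside the hole. It is not an instance of `TmDyn.sem`,
because syntactic dynamism has no rule for `err`. -/
theorem HasType.sem {Γ : Env} {t : Tm} {A : Ty} (h : HasType Γ t A) : Sem Γ Γ t t A A := by
  induction h with
  | err => exact .err
  | var h => exact .var h h
  | cast _ ih => exact ih.cast (.refl _) (.refl _)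
  | unit => exact .unit
  | pair _ _ ih ih' => exact ih.pair ih'
  | letPair _ _ ih ih' => exact ih.letPair ih'
  | inl _ ih => exact ih.inl
  | inr _ ih => exact ih.inr
  | case _ _ _ ih ih' ih'' => exact ih.case ih' ih''
  | lam _ ih => exact ih.lam
  | app _ _ ih ih' => exact ih.app ih'

/-! ## Program contexts -/

/-- The tuple of the variables with indices `i, i + 1, …` for the entries of an environment. -/
def varTuple : ℕ → Env → Tm
  | _, [] => .unit
  | i, _ :: Γ => .pair (.var i) (varTuple (i + 1) Γ)

/-- The product of the types in an environment. -/
def envProd : Env → Ty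
  | [] => .unit
  | A :: Γ => .prod A (envProd Γ)

theorem hasType_varTuple_iff {Γ Δ : Env} {i : ℕ} :
    HasType Δ (varTuple i Γ) (envProd Γ) ↔ ∀ (j : ℕ) A, Γ[j]? = some A → Δ[i + j]? = some A := by
  induction Γ generalizing i with
  | nil => simpa [varTuple, envProd] using HasType.unit
  | cons B Γ ih =>
    constructor
    · intro h
      cases h with | pair h h' =>
      rintro (_ | j) A hj
      · cases h; simp_all
      · have := ih.1 h' j A (by simpa using hj)
        rwa [add_assoc, add_comm 1 j] at this
    · intro h
      refine .pair (.var (h 0 B rfl)) (ih.2 fun j A hj => ?_)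
      rw [add_right_comm, add_assoc]
      exact h (j + 1) A (by simpa using hj)

theorem Sem.weaken {Γ Δ : Env} {t t' : Tm} {A : Ty} (h : Sem Γ Γ t t' A A)
    (hΔ : ∀ (i : ℕ) B, Γ[i]? = some B → Δ[i]? = some B) : Sem Δ Δ t t' A A := by
  intro d n γ₁ γ₂ hγ
  refine h d n γ₁ γ₂ fun i A₁ A₂ h₁ h₂ => hγ i A₁ A₂ (hΔ _ _ h₁) (hΔ _ _ h₂)

/-- A term that has no type but `A`, in no environments but extensions of `Γ`. -/
def rigid (Γ : Env) (A : Ty) : Tm := .cast (envProd Γ) A (varTuple 0 Γ)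

theorem hasType_rigid (Γ : Env) (A : Ty) : HasType Γ (rigid Γ A) A :=
  .cast (hasType_varTuple_iff.2 fun j A h => by simpa using h)

/-- `Ctx.Typed` gives no derivation for the context itself. Plugging in `rigid` recovers one: its
cast forces type `A` at the hole, and its tuple of variables forces the environment there to extend
`Γ`. A term such as `err` would reveal nothing. -/
theorem Sem.plug {Γ : Env} {t t' : Tm} {A : Ty} (h : Sem Γ Γ t t' A A) {C : Ctx} {Δ : Env}
    {B : Ty} (hC : HasType Δ (C.plug (rigid Γ A)) B) : Sem Δ Δ (C.plug t) (C.plug t') B B := by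
  induction C generalizing Δ B with
  | hole =>
    cases hC with | cast hC =>
    exact h.weaken fun i B hi => by simpa using hasType_varTuple_iff.1 hC i B hi
  | cast _ _ _ ih => cases hC with | cast h => exact (ih h).cast (.refl _) (.refl _)
  | pairL _ _ ih => cases hC with | pair h h' => exact (ih h).pair h'.sem
  | pairR _ _ ih => cases hC with | pair h h' => exact h.sem.pair (ih h')
  | letPairL _ _ ih => cases hC with | letPair h h' => exact (ih h).letPair h'.sem
  | letPairR _ _ ih => cases hC with | letPair h h' => exact h.sem.letPair (ih h')
  | inl _ ih => cases hC with | inl h => exact (ih h).inl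
  | inr _ ih => cases hC with | inr h => exact (ih h).inr
  | case₀ _ _ _ ih => cases hC with | case h h' h'' => exact (ih h).case h'.sem h''.sem
  | case₁ _ _ _ ih => cases hC with | case h h' h'' => exact h.sem.case (ih h') h''.sem
  | case₂ _ _ _ ih => cases hC with | case h h' h'' => exact h.sem.case h'.sem (ih h'')
  | lam _ _ ih => cases hC with | lam h => exact (ih h).lam
  | appL _ _ ih => cases hC with | app h h' => exact (ih h).app h'.sem
  | appR _ _ ih => cases hC with | app h h' => exact h.sem.app (ih h')

theorem Sem.adequate {t t' : Tm} {A : Ty} (h : Sem [] [] t t' A A) :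
    ReducesToErr t ∨ (ReducesToValue t ∧ ReducesToValue t') ∨ (Diverges t ∧ Diverges t') := by
  have hr : ∀ (d : Side) u, Steps (d.pick t t') u → Irred u →
      ReducesToErr t ∨ (ReducesToValue t ∧ ReducesToValue t') := by
    intro d u hs hu
    obtain ⟨k, hk⟩ := hs.exists_stepN
    -- The index is the length of the terminating reduction on side `d`.
    have hE := h d k .var .var (fun i _ _ h => by simp at h)
    rw [Tm.subst_var, Tm.subst_var] at hE
    refine (hE k le_rfl u hk hu).imp_right fun ⟨u₁, u₂, h₁, h₂, hv⟩ => ?_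
    exact ⟨⟨_, hv.value.1, h₁⟩, ⟨_, hv.value.2, h₂⟩⟩
  rcases exists_steps_irred_or_diverges t with ⟨u, hs, hu⟩ | hd
  · exact (hr .left u hs hu).imp_right .inl
  rcases exists_steps_irred_or_diverges t' with ⟨u, hs, hu⟩ | hd'
  · exact (hr .right u hs hu).imp_right .inl
  · exact .inr (.inr ⟨hd, hd'⟩)

theorem Sem.obsApprox {Γ : Env} {t t' : Tm} {A : Ty} (h : Sem Γ Γ t t' A A)
    (ht : HasType Γ t A) (ht' : HasType Γ t' A) : ObsApprox Γ t t' A :=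
  ⟨ht, ht', fun _ _ hC => (h.plug (hC _ (hasType_rigid Γ A))).adequate⟩

/-! ## Casting an environment -/

theorem HasType.weaken {Γ : Env} {t : Tm} {A : Ty} (h : HasType Γ t A) {Δ : Env}
    (hΔ : ∀ (i : ℕ) B, Γ[i]? = some B → Δ[i]? = some B) : HasType Δ t A := by
  have lift : ∀ {Γ Δ : Env} {A : Ty}, (∀ (i : ℕ) B, Γ[i]? = some B → Δ[i]? = some B) →
      ∀ (i : ℕ) B, (A :: Γ)[i]? = some B → (A :: Δ)[i]? = some B := by
    rintro Γ Δ A h (_ | i) B hi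
    · exact hi
    · exact h i B hi
  induction h generalizing Δ with
  | err => exact .err
  | var h => exact .var (hΔ _ _ h)
  | cast _ ih => exact .cast (ih hΔ)
  | unit => exact .unit
  | pair _ _ ih ih' => exact .pair (ih hΔ) (ih' hΔ)
  | letPair _ _ ih ih' => exact .letPair (ih hΔ) (ih' (lift (lift hΔ)))
  | inl _ ih => exact .inl (ih hΔ)
  | inr _ ih => exact .inr (ih hΔ)
  | case _ _ _ ih ih' ih'' => exact .case (ih hΔ) (ih' (lift hΔ)) (ih'' (lift hΔ))
  | lam _ ih => exact .lam (ih (lift hΔ))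
  | app _ _ ih ih' => exact .app (ih hΔ) (ih' hΔ)

/-- Here `Γ₁` is the outer part still to be bound. In the intended use `k + 1` is the length of the
whole environment, so its entries start at offset `k + 1 - Γ₁.length` in `Γ`. -/
theorem hasType_envLetAux {k : ℕ} {Γ Γ₁ Γ₂ : Env} {t : Tm} {B : Ty}
    (hlen : Γ₁.length = Γ₂.length)
    (hΓ : ∀ (i : ℕ) A, Γ₁[i]? = some A → Γ[k + 1 - Γ₁.length + i]? = some A)
    (hk : Γ₁.length ≤ k + 1) (ht : HasType (Γ₂ ++ Γ) t B) :
    HasType Γ (envLetAux k Γ₁ Γ₂ t) B := by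
  induction Γ₁ generalizing Γ₂ t with
  | nil =>
    obtain rfl := List.length_eq_zero_iff.1 hlen.symm
    exact ht
  | cons A₁ Γ₁ ih =>
    cases Γ₂ with
    | nil => simp at hlen
    | cons A₂ Γ₂ =>
    simp only [List.length_cons, add_left_inj] at hlen hk hΓ
    refine ih hlen (fun i A hi => ?_) (by omega) (.app (.lam ht) (.cast (.var ?_)))
    · have := hΓ (i + 1) A (by simpa using hi)
      rw [← this]; congr 1; omega
    · rw [List.getElem?_append_right (by omega), ← hΓ 0 A₁ rfl]
      congr 1; omega

/-- Extend a substitution by terms for the first variables. -/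
def appSub (δ : List Tm) (γ : ℕ → Tm) : ℕ → Tm := δ.foldr consSub γ

theorem appSub_add (δ : List Tm) (γ : ℕ → Tm) (i : ℕ) : appSub δ γ (δ.length + i) = γ i := by
  induction δ with
  | nil => simp [appSub]
  | cons v δ ih =>
    rw [List.length_cons, add_right_comm]
    exact ih

theorem appSub_lt {δ : List Tm} (γ : ℕ → Tm) {i : ℕ} {v : Tm} (h : δ[i]? = some v) :
    appSub δ γ i = v := by
  induction δ generalizing i with
  | nil => simp at h
  | cons w δ ih =>
    cases i with
    | zero => simpa [appSub, consSub] using h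
    | succ i => exact ih (i := i) (by simpa using h)

theorem steps_envLetAux {k : ℕ} {Γ₁ Γ₂ : Env} {δ : List Tm} {γ : ℕ → Tm} (t : Tm)
    (h₁ : Γ₁.length = δ.length) (h₂ : Γ₂.length = δ.length) (hk : δ.length ≤ k + 1)
    (hδ : ∀ i A₁ A₂ v, Γ₁[i]? = some A₁ → Γ₂[i]? = some A₂ → δ[i]? = some v →
      Value v ∧ Steps (.cast A₁ A₂ (γ (k + 1 - δ.length + i))) v) :
    Steps ((envLetAux k Γ₁ Γ₂ t).subst γ) (t.subst (appSub δ γ)) := by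
  induction δ generalizing Γ₁ Γ₂ t with
  | nil =>
    obtain rfl := List.length_eq_zero_iff.1 h₁
    exact .refl
  | cons v δ ih =>
    obtain _ | ⟨A₁, Γ₁⟩ := Γ₁
    · simp at h₁
    obtain _ | ⟨A₂, Γ₂⟩ := Γ₂
    · simp at h₂
    simp only [List.length_cons, add_left_inj] at h₁ h₂ hk hδ
    refine (ih (.letIn A₂ (.cast A₁ A₂ (.var k)) t) h₁ h₂ (by omega)
      fun i B₁ B₂ w hB₁ hB₂ hw => ?_).trans ?_
    · have := hδ (i + 1) B₁ B₂ w (by simpa using hB₁) (by simpa using hB₂) (by simpa using hw)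
      rwa [show k + 1 - (δ.length + 1) + (i + 1) = k + 1 - δ.length + i by omega] at this
    · obtain ⟨hv, hs⟩ := hδ 0 A₁ A₂ v rfl rfl rfl
      -- Index `k` skips the `δ.length` values bound by the outer lets and lands on the original
      -- variable.
      have hγ : appSub δ γ k = γ (k + 1 - (δ.length + 1) + 0) := by
        rw [← appSub_add δ γ]; congr 1; omega
      rw [← hγ] at hs
      refine Relation.ReflTransGen.tail
        (Steps.plug (K := .appR (.lam A₂ (t.subst (liftSub (appSub δ γ)))) .hole)
          (.appR .lam .hole) hs hv.ne_err) ?_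
      have := (Red.beta (A := A₂) (t := t.subst (liftSub (appSub δ γ))) hv).step
      rwa [Tm.subst_liftSub_inst] at this

theorem Sem.envLet {Γ₁ Γ₂ : Env} {t₁ t₂ : Tm} {A₁ A₂ : Ty} (h : Sem Γ₁ Γ₂ t₁ t₂ A₁ A₂)
    (hΓ : EnvDyn Γ₁ Γ₂) (hA : Le A₁ A₂) :
    Sem Γ₁ Γ₁ (.cast A₁ A₂ t₁) (envLet Γ₁ Γ₂ t₂) A₂ A₂ := by
  intro d n γ₁ γ₂ hγ
  have hlen : Γ₁.length = Γ₂.length := hΓ.length_eq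
  have hv : ∀ i : Fin Γ₁.length, ∃ v, Steps (.cast (Γ₁[i]) (Γ₂[i]) (γ₂ i)) v ∧
      ValueRel d n Γ₁[i] Γ₂[i] (γ₁ i) v := by
    intro i
    have hi := hγ i Γ₁[i] Γ₁[i] (by simp) (by simp)
    -- A square with the identity on the left: the left value cannot fail, so the right cast must
    -- produce a value related to it.
    rcases castRel (.refl _) (hΓ.get i.2 (hlen ▸ i.2)).le n _ _ _ _ hi .id .cast with
      he | ⟨u₁, u₂, h₁, h₂, hu⟩
    · exact absurd (hi.value.1.irred.eq_of_steps he).symm hi.value.1.ne_err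
    · obtain rfl := hi.value.1.irred.eq_of_steps h₁
      exact ⟨u₂, h₂, hu⟩
  choose f hf hfV using hv
  have hs : Steps ((LambdaG.envLet Γ₁ Γ₂ t₂).subst γ₂) (t₂.subst (appSub (List.ofFn f) γ₂)) := by
    refine steps_envLetAux t₂ (by simp) (by simp [hlen]) (by simp; omega) ?_
    intro i B₁ B₂ v h₁ h₂ hv
    obtain ⟨hi, rfl⟩ := List.getElem?_eq_some_iff.1 h₁
    obtain ⟨_, rfl⟩ := List.getElem?_eq_some_iff.1 h₂
    simp only [List.getElem?_ofFn, hi, dite_true, Option.some.injEq] at hv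
    subst hv
    have := hf ⟨i, hi⟩
    -- The truncated `Γ₁.length - 1` is harmless, since `i < Γ₁.length` makes the length positive.
    rw [List.length_ofFn, show Γ₁.length - 1 + 1 - Γ₁.length + i = i by omega]
    exact ⟨(hfV ⟨i, hi⟩).value.2, this⟩
  refine TermRel.expand .refl hs ?_
  -- Dually, the result is compared through a square with the identity on the right.
  refine (h d n γ₁ _ ?_).bind (K₁ := .cast A₁ A₂ .hole) (K₂ := .hole) (.cast .hole) .hole
    fun j _ _ _ hv => (castRel hA (.refl _) j _ _ _ _ hv .cast .id).termRel
  intro i B₁ B₂ h₁ h₂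
  obtain ⟨hi, rfl⟩ := List.getElem?_eq_some_iff.1 h₁
  obtain ⟨_, rfl⟩ := List.getElem?_eq_some_iff.1 h₂
  rw [appSub_lt γ₂ (v := f ⟨i, hi⟩) (by simp [hi])]
  exact hfV ⟨i, hi⟩

theorem hasType_envLet {Γ₁ Γ₂ : Env} {t : Tm} {B : Ty} (hlen : Γ₁.length = Γ₂.length)
    (ht : HasType Γ₂ t B) : HasType Γ₁ (envLet Γ₁ Γ₂ t) B := by
  refine hasType_envLetAux hlen (fun i A hi => ?_) (by omega) (ht.weaken fun i A hi => ?_)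
  · have := (List.getElem?_eq_some_iff.1 hi).1
    rw [← hi]; congr 1; omega
  · rw [List.getElem?_append_left (List.getElem?_eq_some_iff.1 hi).1, hi]

end LambdaG

theorem mainTheorem1 (Γ₁ Γ₂ : LambdaG.Env) (t₁ t₂ : LambdaG.Tm) (A₁ A₂ : LambdaG.Ty)
    (h : LambdaG.TmDyn Γ₁ Γ₂ t₁ t₂ A₁ A₂) : LambdaG.ObsTmDyn Γ₁ Γ₂ t₁ t₂ A₁ A₂ := by
  obtain ⟨hΓ, hA⟩ := h.ty_le
  obtain ⟨h₁, h₂⟩ := h.hasType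
  exact ⟨hΓ, hA, h₁, h₂, (h.sem.envLet hΓ hA.le).obsApprox (.cast h₁)
    (LambdaG.hasType_envLet hΓ.length_eq h₂)⟩
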